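/- Let $n\ge 6$ and let $X\subset\mathbb R^{n(n-1)/2}$ be the set of incidence vectors of the Hamiltonian cycles of the complete graph $K_n$ on the vertex set $V$, with coordinates $x_{uv}$ indexed by the edges $\{u,v\}$. For $f:X\to\mathbb R$ let $q_f(p)=\frac1{|X|}\sum_{x\in X}f(x)\,p(x)^2$ for polynomials $p$ on $\mathbb R^{n(n-1)/2}$. On the space of polynomials of degree at most $1$, the eigenvalues of $q_f$ are those of its matrix in the basis of monomials $1,x_{12},x_{13},\dots$ (taken as orthonormal). Let $P_1$ be the set of restrictions $f$ to $X$ of linear functions that have average value $1$ on $X$ and for which $q_f$ is positive semidefinite on polynomials of degree at most $1$. For $U\subset V$ with $|U|=m$, $3\le m\le n/2$, let $h_U(x)=c\bigl(\sum_{u\in U,\,v\in V\setminus U}x_{uv}-2\bigr)$ on $X$, where $c$ is chosen so that $h_U$ has average value $1$ on $X$; $h_U$ is the restriction to $X$ of a linear function. Let $\mathbb 1$ be the constant function $1$ on $X$. Then, for every such $U$ and every $a\in\mathbb R$, the quadratic form $q_{ah_U+(1-a)\mathbb 1}$ on polynomials of degree at most $1$ has exactly the following $\frac{n(n-1)}2+1$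 eigenvalues, counted with multiplicity (multiplicities of values that coincide are added): - $0$, with multiplicity $n$; - $a\frac{2(m-2)}{(n-2)(m-1)}+(1-a)\frac2{n-1}$, with multiplicity $\frac{m(m-3)}2$; - $a\frac{2(n-m-2)}{(n-2)(n-m-1)}+(1-a)\frac2{n-1}$, with multiplicity $\frac{(n-m)(n-m-3)}2$; - $a\frac{2(mn^2-nm^2-n^2+4n-3mn+3m^2-4)}{(n-2)(n-3)(mn-m^2-n+1)}+(1-a)\frac2{n-1}$, with multiplicity $(n-m-1)(m-1)$; - $a\frac{2(m-2)}{(n-3)(m-1)}+(1-a)\frac2{n-1}$, with multiplicity $m-1$; - $a\frac{2(n-m-2)}{(n-3)(n-m-1)}+(1-a)\frac2{n-1}$, with multiplicity $n-m-1$; - $\alpha+\sqrt\beta$ and $\alpha-\sqrt\beta$, each with multiplicity $1$, where, with $t=m(n-m)$ and $s=(m-1)(n-m-1)$, $\alpha$ and $\beta\ge0$ are the rational functions of $a,m,n$ $$\alpha=\frac{3n+1}{2(n-1)}-\frac{a(n^2-1-4t)}{(n-1)(n-3)s},$$ $$\beta=\frac94+\frac{3a(n^2-1-4t)}{(n-1)(n-3)s}+a^2\,\frac{2(3n^2-16n+25)t^2-2(n-1)(3n^2-12n+17)t+(n-1)(n-2)(n+1)^2}{(n-1)(n-2)(n-3)^2s^2}.$$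 Moreover, if $a=\sqrt n$, then $\alpha-\sqrt\beta\le0$ for all such $m$; and the function $\sqrt n\,h_U+(1-\sqrt n)\mathbb 1$ lies outside $P_1$ or on the boundary of $P_1$ (relative to the affine span of $P_1$). -/

import Mathlib

namespace TSP

/-- Edges of the complete graph `K_n`: unordered pairs of distinct vertices. -/
abbrev Edge (n : ℕ) : Type := {e : Sym2 (Fin n) // ¬ e.IsDiag}

/-- Hamiltonian cycles of `K_n`, each identified with its set of edges (so that a cycle does not
depend on a starting vertex or on an orientation). -/
abbrev Tour (n : ℕ) : Type :=
  {H : Finset (Sym2 (Fin n)) // ∃ (v : Fin n) (w : (⊤ : SimpleGraph (Fin n)).Walk v v),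
    w.IsHamiltonianCycle ∧ w.edges.toFinset = H}

noncomputable instance (n : ℕ) : Fintype (Tour n) := Fintype.ofFinite _

/-- The coordinate `x_e` of the incidence vector of a tour: `1` if `e` is an edge of the tour and
`0` otherwise. -/
def Tour.x {n : ℕ} (T : Tour n) (e : Sym2 (Fin n)) : ℝ := if e ∈ T.1 then 1 else 0

/-- The incidence vector of a tour, a point of `ℝ^{n(n-1)/2}`. The incidence vectors of the tours
form the set `X`; functions on `X` are represented as functions on `Tour n`. -/
def Tour.vec {n : ℕ} (T : Tour n) : Edge n → ℝ := fun e => T.x e.1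

/-- The average of a function over `X`. -/
noncomputable def avg {n : ℕ} (f : Tour n → ℝ) : ℝ :=
  (∑ T : Tour n, f T) / (Fintype.card (Tour n) : ℝ)

/-- `f : X → ℝ` is the restriction to `X` of a linear function on `ℝ^{n(n-1)/2}`. -/
def IsLinearOnTours {n : ℕ} (f : Tour n → ℝ) : Prop :=
  ∃ L : (Edge n → ℝ) →ₗ[ℝ] ℝ, ∀ T : Tour n, f T = L T.vec

/-- The quadratic form `q_f(p) = (1/|X|) ∑_{x ∈ X} f(x) p(x)²` on polynomials `p` on
`ℝ^{n(n-1)/2}`. -/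
noncomputable def q {n : ℕ} (f : Tour n → ℝ) (p : MvPolynomial (Edge n) ℝ) : ℝ :=
  avg fun T => f T * (MvPolynomial.eval T.vec p) ^ 2

/-- The set `P_k`: linear functions on `X` with average value `1` whose form `q_f` is positive
semidefinite on the polynomials of degree at most `k`. -/
def P (n k : ℕ) : Set (Tour n → ℝ) :=
  {f | IsLinearOnTours f ∧ avg f = 1 ∧
    ∀ p : MvPolynomial (Edge n) ℝ, p.totalDegree ≤ k → 0 ≤ q f p}

/-- The monomials `1, x_{12}, x_{13}, …`, the distinguished orthonormal basis of the
`(n(n-1)/2 + 1)`-dimensional space of polynomials of degree at most `1`. -/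
noncomputable def mono {n : ℕ} : Option (Edge n) → MvPolynomial (Edge n) ℝ
  | none => 1
  | some e => MvPolynomial.X e

/-- The symmetric matrix `A_f` of `q_f`, restricted to polynomials of degree at most `1`, in the
basis of monomials. -/
noncomputable def formMatrix {n : ℕ} (f : Tour n → ℝ) :
    Matrix (Option (Edge n)) (Option (Edge n)) ℝ :=
  Matrix.of fun i j =>
    avg fun T => f T * (MvPolynomial.eval T.vec (mono i) * MvPolynomial.eval T.vec (mono j))

/-- `formMatrix f` represents `q_f`. -/
theorem q_eq_formMatrix {n : ℕ} (f : Tour n → ℝ) (c : Option (Edge n) → ℝ) :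
    q f (∑ i, c i • mono i) = c ⬝ᵥ (formMatrix f).mulVec c := by
  simp only [q, avg, formMatrix, dotProduct, Matrix.mulVec, Matrix.of_apply, map_sum,
    MvPolynomial.smul_eval, sq, Finset.mul_sum, Finset.sum_div,
    Finset.sum_mul]
  rw [Finset.sum_comm]
  refine Finset.sum_congr rfl fun i _ => ?_
  rw [Finset.sum_comm]
  refine Finset.sum_congr rfl fun j _ => Finset.sum_congr rfl fun T _ => ?_
  ring

/-- The eigenvalues of `q_f` on polynomials of degree at most `1`, listed with multiplicity. -/
noncomputable def eigenvalues {n : ℕ} (f : Tour n → ℝ) : Multiset ℝ :=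
  (formMatrix f).charpoly.roots

/-- `∑_{u ∈ U, v ∉ U} x_{uv} - 2`; the subtour elimination constraint says that it is `≥ 0`. -/
def cutExcess {n : ℕ} (U : Finset (Fin n)) (T : Tour n) : ℝ :=
  (∑ u ∈ U, ∑ v ∈ Uᶜ, T.x s(u, v)) - 2

/-- The function `h_U = c (∑_{u ∈ U, v ∉ U} x_{uv} - 2)` with `c` chosen so that its average value
over `X` is `1`. -/
noncomputable def h {n : ℕ} (U : Finset (Fin n)) (T : Tour n) : ℝ :=
  (avg (cutExcess U))⁻¹ * cutExcess U T

/-- The function `a h_U + (1 - a) 𝟙`, that is, `h_U` scaled by `a` from the centre `𝟙`. -/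
noncomputable def scaled {n : ℕ} (a : ℝ) (U : Finset (Fin n)) : Tour n → ℝ :=
  fun T => a * h U T + (1 - a) * 1

/-- The rational function `α` of `a, m, n`. -/
noncomputable def alpha (a m n : ℝ) : ℝ :=
  (3 * n + 1) / (2 * (n - 1)) -
    a * (n ^ 2 - 1 - 4 * m * (n - m)) / ((n - 1) * (n - 3) * (m - 1) * (n - m - 1))

/-- The rational function `β` of `a, m, n`. -/
noncomputable def beta (a m n : ℝ) : ℝ :=
  9 / 4 +
    3 * a * (n ^ 2 - 1 - 4 * m * (n - m)) / ((n - 1) * (n - 3) * (m - 1) * (n - m - 1)) +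
    a ^ 2 * (2 * (3 * n ^ 2 - 16 * n + 25) * (m * (n - m)) ^ 2
        - 2 * (n - 1) * (3 * n ^ 2 - 12 * n + 17) * (m * (n - m))
        + (n - 1) * (n - 2) * (n + 1) ^ 2) /
      ((n - 1) * (n - 2) * (n - 3) ^ 2 * (m - 1) ^ 2 * (n - m - 1) ^ 2)

end TSP

/-!
On the tours, the degree equations `∑_v x_{uv} = 2` turn every affine function into one of the form
`c + ∑ M_{uv} x_{uv}` with `M` balanced, that is, with weights summing to zero at every vertex. In
this normal form `h_U = 1 + X`, where `X` comes from the three-valued weighting `cutWeight U`.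

*Moments.* The uniform distribution on tours is invariant under relabelling, so a moment of
coordinates depends only on the shape of the set of edges; the degree equations then determine all
moments of order at most three recursively (`avg_mul_x`), starting from the fact that a tour has no
vertex of degree three and no triangle. Against balanced weightings almost all terms cancel, and
the third moments take the compact form `avg_x_mul_form_mul_form`.

*Spectrum.* The form matrix commutes with the permutations that preserve `U`. Its coefficient space
is the direct sum of the polynomials `∑ ψ_v (∑_u x_{uv} - 2)`, which vanish on all tours and form
the kernel block of dimension `n`; the balanced weightings inside `U`, inside its complement, and
across; those induced from vertex weightings with sum zero on `U` or on its complement; and a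
two-dimensional invariant block. On the five middle blocks the matrix is a scalar, and on the last
it is `invariantMatrix`, with trace `2α` and determinant `α² - β`. Independence of the blocks
(`blocks_independent`) together with lower bounds for their dimensions by counting equations gives
the decomposition (`finrank_blocks`), and the characteristic polynomial is the product over the
blocks. Thus no distinctness of eigenvalues is needed.

*Scaling by `√n`.* The determinant `α² - β` is negative at `a = √n`
(`det_invariantMatrix_sqrt_neg`). Hence `α - √β < 0` is an eigenvalue of the form, which is
therefore not positive semidefinite: the scaled function always lies strictly outside `P_1`.
-/

namespace TSP

open Finset Module

variable {n : ℕ}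

/-! ### Tours: symmetry, degrees, and absence of triangles -/

lemma Tour.x_sq (T : Tour n) (e : Sym2 (Fin n)) : T.x e * T.x e = T.x e := by
  unfold Tour.x; split_ifs <;> simp

lemma Tour.not_mem_diag (T : Tour n) (u : Fin n) : s(u, u) ∉ T.1 := by
  obtain ⟨H, v, w, -, rfl⟩ := T
  intro h
  have := w.edges_subset_edgeSet (List.mem_toFinset.1 h)
  simp at this

lemma Tour.x_diag (T : Tour n) (u : Fin n) : T.x s(u, u) = 0 := by
  simp [Tour.x, T.not_mem_diag u]

/-- Relabelling the vertices of a tour by a permutation. -/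
def Tour.relabel (π : Equiv.Perm (Fin n)) (T : Tour n) : Tour n :=
  ⟨T.1.map ⟨Sym2.map π, Sym2.map.injective π.injective⟩, by
    obtain ⟨H, v, w, hw, rfl⟩ := T
    let φ : (⊤ : SimpleGraph (Fin n)) →g (⊤ : SimpleGraph (Fin n)) :=
      ⟨π, fun h => by simpa using h⟩
    refine ⟨φ v, w.map φ, hw.map (f := φ) π.bijective, ?_⟩
    ext e
    rw [List.mem_toFinset, SimpleGraph.Walk.edges_map]
    simp [φ]⟩

lemma Tour.x_relabel (π : Equiv.Perm (Fin n)) (T : Tour n) (u v : Fin n) :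
    (T.relabel π).x s(π u, π v) = T.x s(u, v) := by
  have : s(π u, π v) =
      (⟨Sym2.map π, Sym2.map.injective π.injective⟩ : Sym2 (Fin n) ↪ Sym2 (Fin n)) s(u, v) := rfl
  simp only [Tour.x, Tour.relabel, this, Finset.mem_map']

lemma Tour.relabel_injective (π : Equiv.Perm (Fin n)) :
    Function.Injective (Tour.relabel π) := fun _ _ h =>
  Subtype.ext (Finset.map_injective _ (congrArg Subtype.val h))

/-- The uniform distribution on tours is invariant under relabelling. -/
lemma avg_relabel (π : Equiv.Perm (Fin n)) (f : Tour n → ℝ) :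
    avg (fun T => f (T.relabel π)) = avg f := by
  unfold avg
  congr 1
  exact Function.Bijective.sum_comp
    (Finite.injective_iff_bijective.1 (Tour.relabel_injective π)) f

/-- The edges of a tour at a given vertex number exactly two. -/
lemma Tour.sum_x (T : Tour n) (u : Fin n) : ∑ v, T.x s(u, v) = 2 := by
  obtain ⟨H, v, w, hw, rfl⟩ := T
  have h := hw.isCycle.ncard_neighborSet_toSubgraph_eq_two (hw.mem_support u)
  have h2 : w.toSubgraph.neighborSet u =
      ((univ.filter fun v => s(u, v) ∈ w.edges.toFinset : Finset (Fin n)) : Set (Fin n)) := by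
    ext x
    simp [SimpleGraph.Subgraph.mem_neighborSet, ← SimpleGraph.Subgraph.mem_edgeSet]
  rw [h2, Set.ncard_coe_finset] at h
  simp only [Tour.x, Finset.sum_boole, h]
  norm_num

lemma Tour.x_nonneg (T : Tour n) (e : Sym2 (Fin n)) : 0 ≤ T.x e := by
  unfold Tour.x; split_ifs <;> simp

/-- A vertex is on no three distinct edges of a tour. -/
lemma Tour.star (T : Tour n) {u a b c : Fin n} (hab : a ≠ b) (hac : a ≠ c) (hbc : b ≠ c) :
    T.x s(u, a) * T.x s(u, b) * T.x s(u, c) = 0 := by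
  by_contra h
  have h1 : T.x s(u, a) + (T.x s(u, b) + T.x s(u, c)) ≤ 2 := by
    rw [← T.sum_x u]
    have : ∑ v ∈ ({a, b, c} : Finset (Fin n)), T.x s(u, v) =
        T.x s(u, a) + (T.x s(u, b) + T.x s(u, c)) := by
      rw [Finset.sum_insert (by simp [hab, hac]), Finset.sum_pair hbc]
    rw [← this]
    exact Finset.sum_le_sum_of_subset_of_nonneg (Finset.subset_univ _)
      fun _ _ _ => T.x_nonneg _
  unfold Tour.x at h h1
  split_ifs at h h1 <;> first | norm_num at h; done | norm_num at h1

/-- A tour on at least four vertices contains no triangle: the three vertices would have no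
further neighbours, contradicting connectedness. -/
lemma Tour.triangle (hn : 4 ≤ n) (T : Tour n) {a b c : Fin n} (hab : a ≠ b) (hac : a ≠ c)
    (hbc : b ≠ c) : T.x s(a, b) * T.x s(b, c) * T.x s(a, c) = 0 := by
  by_contra h
  have hT : s(a, b) ∈ T.1 ∧ s(b, c) ∈ T.1 ∧ s(a, c) ∈ T.1 := by
    unfold Tour.x at h
    split_ifs at h <;> simp_all
  obtain ⟨h1, h2, h3⟩ := hT
  -- the vertex set of the triangle is closed under adjacency in the tour
  have key : ∀ p q r : Fin n, p ≠ q → p ≠ r → q ≠ r → s(p, q) ∈ T.1 → s(p, r) ∈ T.1 →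
      ∀ v, s(p, v) ∈ T.1 → v = q ∨ v = r := by
    intro p q r _ _ hqr hq hr v hv
    by_contra hne
    push Not at hne
    have := T.star (u := p) hqr hne.1.symm hne.2.symm
    simp [Tour.x, hq, hr, hv] at this
  have closed : ∀ p ∈ ({a, b, c} : Finset (Fin n)), ∀ v, s(p, v) ∈ T.1 →
      v ∈ ({a, b, c} : Finset (Fin n)) := by
    intro p hp v hv
    simp only [Finset.mem_insert, Finset.mem_singleton] at hp ⊢
    rcases hp with rfl | rfl | rfl
    · have := key p b c hab hac hbc h1 h3 v hv; tauto
    · have := key p a c hab.symm hbc hac (Sym2.eq_swap ▸ h1) h2 v hv; tauto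
    · have := key p a b hac.symm hbc.symm hab (Sym2.eq_swap ▸ h3) (Sym2.eq_swap ▸ h2) v hv; tauto
  obtain ⟨H, v, w, hw, rfl⟩ := T
  have hsupp : ∀ d, d ∈ ({a, b, c} : Finset (Fin n)) := by
    intro d
    have hconn := (w.toSubgraph_connected).preconnected
    have ha : a ∈ w.toSubgraph.verts := by simpa using hw.mem_support a
    have hd : d ∈ w.toSubgraph.verts := by simpa using hw.mem_support d
    obtain ⟨p⟩ := hconn.coe ⟨a, ha⟩ ⟨d, hd⟩
    have gen : ∀ {x y : w.toSubgraph.verts} (p : w.toSubgraph.coe.Walk x y),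
        x.1 ∈ ({a, b, c} : Finset (Fin n)) → y.1 ∈ ({a, b, c} : Finset (Fin n)) := by
      intro x y p
      induction p with
      | nil => exact id
      | cons hadj _ ih =>
        intro hx
        refine ih (closed _ hx _ ?_)
        rw [List.mem_toFinset, ← SimpleGraph.Walk.mem_edges_toSubgraph]
        exact hadj
    exact gen p (by simp)
  have : (univ : Finset (Fin n)).card ≤ ({a, b, c} : Finset (Fin n)).card :=
    Finset.card_le_card fun d _ => hsupp d
  have h3 := Finset.card_le_three (a := a) (b := b) (c := c)
  simp at this
  omega

lemma nonempty_tour (hn : 3 ≤ n) : Nonempty (Tour n) := by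
  obtain ⟨k, rfl⟩ := Nat.exists_eq_add_of_le' hn
  have h : (SimpleGraph.cycleGraph.cycle k).IsHamiltonianCycle :=
    SimpleGraph.Walk.isHamiltonianCycle_iff_isCycle_and_length_eq.2
      ⟨SimpleGraph.cycleGraph.isCycle_cycle, by simp [SimpleGraph.cycleGraph.length_cycle]⟩
  exact ⟨⟨_, _, (SimpleGraph.cycleGraph.cycle k).map (.ofLE le_top),
    h.map Function.bijective_id, rfl⟩⟩

/-! ### Moments of order at most three -/

lemma avg_add (f g : Tour n → ℝ) : avg (fun T => f T + g T) = avg f + avg g := by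
  simp only [avg, sum_add_distrib, add_div]

lemma avg_const_mul (c : ℝ) (f : Tour n → ℝ) : avg (fun T => c * f T) = c * avg f := by
  simp only [avg, ← mul_sum, mul_div_assoc]

lemma avg_mul_const (c : ℝ) (f : Tour n → ℝ) : avg (fun T => f T * c) = avg f * c := by
  simp only [avg, ← sum_mul, div_mul_eq_mul_div]

lemma avg_sum {ι : Type*} (s : Finset ι) (f : ι → Tour n → ℝ) :
    avg (fun T => ∑ i ∈ s, f i T) = ∑ i ∈ s, avg (f i) := by
  simp only [avg]
  rw [sum_comm, sum_div]

lemma avg_const (hn : 3 ≤ n) (c : ℝ) : avg (fun _ : Tour n => c) = c := by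
  have := nonempty_tour hn
  have h : (Fintype.card (Tour n) : ℝ) ≠ 0 := by exact_mod_cast Fintype.card_ne_zero
  simp only [avg, sum_const, card_univ, nsmul_eq_mul]
  field_simp

lemma Tour.x_relabel_swap (T : Tour n) {p q z w : Fin n} (hpz : p ≠ z) (hpw : p ≠ w)
    (hqz : q ≠ z) (hqw : q ≠ w) : (T.relabel (Equiv.swap z w)).x s(p, q) = T.x s(p, q) := by
  have := T.x_relabel (Equiv.swap z w) p q
  rwa [Equiv.swap_apply_of_ne_of_ne hpz hpw, Equiv.swap_apply_of_ne_of_ne hqz hqw] at this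

/-- The recursion that determines all moments: if `F` depends only on the vertices in `S`, then
`F x_{yz}` has the same average for every `z ∉ S`, and the degree equation at `y` evaluates it. -/
lemma avg_mul_x (F : Tour n → ℝ) (S : Finset (Fin n)) {y z : Fin n} (hy : y ∈ S) (hz : z ∉ S)
    (hF : ∀ v w, v ∉ S → w ∉ S → ∀ T, F (Tour.relabel (Equiv.swap v w) T) = F T) :
    ((n : ℝ) - #S) * avg (fun T => F T * T.x s(y, z)) =
      2 * avg F - ∑ v ∈ S, avg (fun T => F T * T.x s(y, v)) := by
  have hconst : ∀ v ∈ Sᶜ, avg (fun T => F T * T.x s(y, v)) = avg fun T => F T * T.x s(y, z) := by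
    intro v hv
    rw [mem_compl] at hv
    rw [← avg_relabel (Equiv.swap v z)]
    congr 1
    funext T
    have hyv : y ≠ v := fun h => hv (h ▸ hy)
    have hyz : y ≠ z := fun h => hz (h ▸ hy)
    have h1 := T.x_relabel (Equiv.swap v z) y z
    rw [Equiv.swap_apply_of_ne_of_ne hyv hyz, Equiv.swap_apply_right] at h1
    rw [hF v z hv hz, h1]
  have hsum : ∑ v, avg (fun T => F T * T.x s(y, v)) = 2 * avg F := by
    rw [← avg_sum]
    simp only [← mul_sum, Tour.sum_x, avg_mul_const]
    ring
  rw [← hsum, ← sum_add_sum_compl S, sum_congr rfl hconst, sum_const, card_compl, Fintype.card_fin,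
    nsmul_eq_mul, Nat.cast_sub (by simpa using card_le_univ S)]
  ring

/-- The average of `x_{ab} x_{cd} x_{ef}`. Repeated edges give the moments of lower order. -/
noncomputable def moment (a b c d e f : Fin n) : ℝ :=
  avg fun T : Tour n => T.x s(a, b) * T.x s(c, d) * T.x s(e, f)

lemma avg_x (hn : 3 ≤ n) {a b : Fin n} (hab : a ≠ b) :
    avg (fun T : Tour n => T.x s(a, b)) = 2 / (n - 1) := by
  have h := avg_mul_x (fun _ : Tour n => (1 : ℝ)) {a} (y := a) (z := b) (by simp)
    (by simpa using hab.symm) (fun _ _ _ _ _ => rfl)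
  simp only [card_singleton, one_mul, sum_singleton, Tour.x_diag, avg_const hn] at h
  have : (n : ℝ) - 1 ≠ 0 := by
    have : (3 : ℝ) ≤ n := by exact_mod_cast hn
    linarith
  rw [eq_div_iff this]
  push_cast at h
  linarith

lemma avg_x_adj (hn : 4 ≤ n) {a b c : Fin n} (hab : a ≠ b) (hac : a ≠ c) (hbc : b ≠ c) :
    avg (fun T : Tour n => T.x s(a, b) * T.x s(a, c)) = 2 / ((n - 1) * (n - 2)) := by
  have h := avg_mul_x (fun T : Tour n => T.x s(a, b)) {a, b} (y := a) (z := c) (by simp)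
    (by simp [hac.symm, hbc.symm]) (fun v w hv hw T => by
      simp only [mem_insert, mem_singleton, not_or] at hv hw
      exact T.x_relabel_swap (Ne.symm hv.1) (Ne.symm hw.1) (Ne.symm hv.2) (Ne.symm hw.2))
  simp only [card_pair hab, sum_pair hab, Tour.x_diag, Tour.x_sq, mul_zero,
    avg_const (by omega : 3 ≤ n), avg_x (by omega : 3 ≤ n) hab] at h
  have : (4 : ℝ) ≤ n := by exact_mod_cast hn
  have h1 : (n : ℝ) - 1 ≠ 0 := by linarith
  have h2 : (n : ℝ) - 2 ≠ 0 := by linarith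
  push_cast at h
  rw [eq_div_iff (mul_ne_zero h1 h2)]
  field_simp at h
  linarith

lemma avg_x_disj (hn : 4 ≤ n) {a b c d : Fin n} (hab : a ≠ b) (hac : a ≠ c) (had : a ≠ d)
    (hbc : b ≠ c) (hbd : b ≠ d) (hcd : c ≠ d) :
    avg (fun T : Tour n => T.x s(a, b) * T.x s(c, d)) = 4 / ((n - 1) * (n - 2)) := by
  have h := avg_mul_x (fun T : Tour n => T.x s(a, b)) {a, b, c} (y := c) (z := d) (by simp)
    (by simp [had.symm, hbd.symm, hcd.symm]) (fun v w hv hw T => by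
      simp only [mem_insert, mem_singleton, not_or] at hv hw
      exact T.x_relabel_swap (Ne.symm hv.1) (Ne.symm hw.1) (Ne.symm hv.2.1) (Ne.symm hw.2.1))
  rw [card_eq_three.2 ⟨a, b, c, hab, hac, hbc, rfl⟩, sum_insert (by simp [hab, hac]),
    sum_pair hbc] at h
  have e1 := avg_x_adj hn hab hac hbc
  have e2 := avg_x_adj hn hab.symm hbc hac
  simp only [Sym2.eq_swap (a := b) (b := a)] at e2
  simp only [Sym2.eq_swap (a := c) (b := a), Sym2.eq_swap (a := c) (b := b), Tour.x_diag, mul_zero,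
    avg_const (by omega : 3 ≤ n), avg_x (by omega : 3 ≤ n) hab, e1, e2] at h
  have : (4 : ℝ) ≤ n := by exact_mod_cast hn
  have h1 : (n : ℝ) - 1 ≠ 0 := by linarith
  have h2 : (n : ℝ) - 2 ≠ 0 := by linarith
  have h3 : (n : ℝ) - 3 ≠ 0 := by linarith
  push_cast at h
  rw [← mul_right_inj' h3, h]
  field_simp
  ring

lemma moment_star {a b c d : Fin n} (hbc : b ≠ c) (hbd : b ≠ d) (hcd : c ≠ d) :
    moment a b a c a d = 0 := by
  simp [moment, Tour.star _ hbc hbd hcd, avg]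

lemma moment_triangle (hn : 4 ≤ n) {a b c : Fin n} (hab : a ≠ b) (hac : a ≠ c) (hbc : b ≠ c) :
    moment a b b c a c = 0 := by
  simp [moment, Tour.triangle hn _ hab hac hbc, avg]

lemma moment_swap₁ (a b c d e f : Fin n) : moment b a c d e f = moment a b c d e f := by
  simp only [moment, Sym2.eq_swap (a := b) (b := a)]

lemma moment_swap₂ (a b c d e f : Fin n) : moment a b d c e f = moment a b c d e f := by
  simp only [moment, Sym2.eq_swap (a := d) (b := c)]

lemma moment_swap₃ (a b c d e f : Fin n) : moment a b c d f e = moment a b c d e f := by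
  simp only [moment, Sym2.eq_swap (a := f) (b := e)]

lemma moment_comm₁₂ (a b c d e f : Fin n) : moment c d a b e f = moment a b c d e f := by
  simp only [moment, mul_comm]

lemma moment_comm₂₃ (a b c d e f : Fin n) : moment a b e f c d = moment a b c d e f := by
  simp only [moment, mul_assoc, mul_comm (Tour.x _ s(e, f))]

/-- The moment of a path with three edges. -/
lemma moment_path (hn : 6 ≤ n) {a b c d : Fin n} (hab : a ≠ b) (hac : a ≠ c) (had : a ≠ d)
    (hbc : b ≠ c) (hbd : b ≠ d) (hcd : c ≠ d) :
    moment a b b c c d = 2 / ((n - 1) * (n - 2) * (n - 3)) := by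
  have h := avg_mul_x (fun T : Tour n => T.x s(a, b) * T.x s(b, c)) {a, b, c} (y := c) (z := d)
    (by simp) (by simp [had.symm, hbd.symm, hcd.symm]) (fun v w hv hw T => by
      simp only [mem_insert, mem_singleton, not_or] at hv hw
      rw [T.x_relabel_swap (Ne.symm hv.1) (Ne.symm hw.1) (Ne.symm hv.2.1) (Ne.symm hw.2.1),
        T.x_relabel_swap (Ne.symm hv.2.1) (Ne.symm hw.2.1) (Ne.symm hv.2.2) (Ne.symm hw.2.2)])
  rw [card_eq_three.2 ⟨a, b, c, hab, hac, hbc, rfl⟩, sum_insert (by simp [hab, hac]),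
    sum_pair hbc] at h
  have e2 := avg_x_adj (by omega) hab.symm hbc hac
  simp only [Sym2.eq_swap (a := b) (b := a)] at e2
  have e4 : avg (fun T : Tour n => T.x s(a, b) * T.x s(b, c) * T.x s(b, c)) =
      2 / ((n - 1) * (n - 2)) := by
    simp only [mul_assoc, Tour.x_sq, e2]
  have e3 : avg (fun T : Tour n => T.x s(a, b) * T.x s(b, c) * T.x s(a, c)) = 0 :=
    moment_triangle (by omega) hab hac hbc
  simp only [Sym2.eq_swap (a := c) (b := a), Sym2.eq_swap (a := c) (b := b), Tour.x_diag, mul_zero,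
    avg_const (by omega : 3 ≤ n), e3, e4, e2] at h
  have : (6 : ℝ) ≤ n := by exact_mod_cast hn
  have h1 : (n : ℝ) - 1 ≠ 0 := by linarith
  have h2 : (n : ℝ) - 2 ≠ 0 := by linarith
  have h3 : (n : ℝ) - 3 ≠ 0 := by linarith
  push_cast at h
  rw [moment, ← mul_right_inj' h3, h]
  field_simp
  ring

/-- The moment of a path with two edges and a disjoint edge. -/
lemma moment_path_edge (hn : 6 ≤ n) {a b c d e : Fin n} (hab : a ≠ b) (hac : a ≠ c) (had : a ≠ d)
    (hae : a ≠ e) (hbc : b ≠ c) (hbd : b ≠ d) (hbe : b ≠ e) (hcd : c ≠ d) (hce : c ≠ e)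
    (hde : d ≠ e) :
    moment a b b c d e = 4 / ((n - 1) * (n - 2) * (n - 3)) := by
  have h := avg_mul_x (fun T : Tour n => T.x s(a, b) * T.x s(b, c)) {a, b, c, d} (y := d) (z := e)
    (by simp) (by simp [hae.symm, hbe.symm, hce.symm, hde.symm]) (fun v w hv hw T => by
      simp only [mem_insert, mem_singleton, not_or] at hv hw
      rw [T.x_relabel_swap (Ne.symm hv.1) (Ne.symm hw.1) (Ne.symm hv.2.1) (Ne.symm hw.2.1),
        T.x_relabel_swap (Ne.symm hv.2.1) (Ne.symm hw.2.1) (Ne.symm hv.2.2.1) (Ne.symm hw.2.2.1)])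
  rw [show #{a, b, c, d} = 4 by simp [card_insert_of_notMem, hab, hac, had, hbc, hbd, hcd],
    sum_insert (by simp [hab, hac, had]),
    sum_insert (by simp [hbc, hbd]), sum_pair hcd] at h
  have e2 := avg_x_adj (by omega) hab.symm hbc hac
  simp only [Sym2.eq_swap (a := b) (b := a)] at e2
  have s1 := moment_path hn hbc.symm hac.symm hcd hab.symm hbd had
  rw [moment_swap₁, moment_swap₂, moment_comm₁₂] at s1
  have s2 := moment_star (a := b) hac had hcd
  rw [moment_swap₁] at s2
  have s3 := moment_path hn hab hac had hbc hbd hcd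
  simp only [moment] at s1 s2 s3
  simp only [Sym2.eq_swap (a := d) (b := a), Sym2.eq_swap (a := d) (b := b),
    Sym2.eq_swap (a := d) (b := c), Tour.x_diag, mul_zero,
    avg_const (by omega : 3 ≤ n), e2, s1, s2, s3] at h
  have : (6 : ℝ) ≤ n := by exact_mod_cast hn
  have h1 : (n : ℝ) - 1 ≠ 0 := by linarith
  have h2 : (n : ℝ) - 2 ≠ 0 := by linarith
  have h3 : (n : ℝ) - 3 ≠ 0 := by linarith
  have h4 : (n : ℝ) - 4 ≠ 0 := by linarith
  push_cast at h
  rw [moment, ← mul_right_inj' h4, h]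
  field_simp
  ring

/-- The moment of a matching with three edges. -/
lemma moment_matching (hn : 6 ≤ n) {a b c d e f : Fin n} (hab : a ≠ b) (hac : a ≠ c) (had : a ≠ d)
    (hae : a ≠ e) (haf : a ≠ f) (hbc : b ≠ c) (hbd : b ≠ d) (hbe : b ≠ e) (hbf : b ≠ f)
    (hcd : c ≠ d) (hce : c ≠ e) (hcf : c ≠ f) (hde : d ≠ e) (hdf : d ≠ f) (hef : e ≠ f) :
    moment a b c d e f = 8 / ((n - 1) * (n - 2) * (n - 3)) := by
  have h := avg_mul_x (fun T : Tour n => T.x s(a, b) * T.x s(c, d)) {a, b, c, d, e} (y := e)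
    (z := f) (by simp) (by simp [haf.symm, hbf.symm, hcf.symm, hdf.symm, hef.symm])
    (fun v w hv hw T => by
      simp only [mem_insert, mem_singleton, not_or] at hv hw
      rw [T.x_relabel_swap (Ne.symm hv.1) (Ne.symm hw.1) (Ne.symm hv.2.1) (Ne.symm hw.2.1),
        T.x_relabel_swap (Ne.symm hv.2.2.1) (Ne.symm hw.2.2.1) (Ne.symm hv.2.2.2.1)
          (Ne.symm hw.2.2.2.1)])
  rw [show #{a, b, c, d, e} = 5 by
      simp [card_insert_of_notMem, hab, hac, had, hae, hbc, hbd, hbe, hcd, hce, hde],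
    sum_insert (by simp [hab, hac, had, hae]),
    sum_insert (by simp [hbc, hbd, hbe]), sum_insert (by simp [hcd, hce]), sum_pair hde] at h
  have e2 := avg_x_disj (by omega) hab hac had hbc hbd hcd
  have s1 := moment_path_edge hn hab.symm hbe hbc hbd hae hac had hce.symm hde.symm hcd
  rw [moment_swap₁, moment_comm₂₃, moment_swap₃] at s1
  have s2 := moment_path_edge hn hab hae hac had hbe hbc hbd hce.symm hde.symm hcd
  rw [moment_comm₂₃, moment_swap₃] at s2
  have s3 := moment_path_edge hn hcd.symm hde had.symm hbd.symm hce hac.symm hbc.symm hae.symm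
    hbe.symm hab
  rw [moment_swap₁, moment_comm₂₃, moment_comm₁₂, moment_swap₃] at s3
  have s4 := moment_path_edge hn hcd hce hac.symm hbc.symm hde had.symm hbd.symm hae.symm
    hbe.symm hab
  rw [moment_comm₂₃, moment_comm₁₂, moment_swap₃] at s4
  simp only [moment] at s1 s2 s3 s4
  simp only [Tour.x_diag, mul_zero, avg_const (by omega : 3 ≤ n), e2, s1, s2, s3, s4] at h
  have : (6 : ℝ) ≤ n := by exact_mod_cast hn
  have h1 : (n : ℝ) - 1 ≠ 0 := by linarith
  have h2 : (n : ℝ) - 2 ≠ 0 := by linarith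
  have h3 : (n : ℝ) - 3 ≠ 0 := by linarith
  have h5 : (n : ℝ) - 5 ≠ 0 := by linarith
  push_cast at h
  rw [moment, ← mul_right_inj' h5, h]
  field_simp
  ring

/-! ### Averages of products of balanced linear forms -/

/-- The linear form `∑ M_{uv} x_{uv}`, summed over the edges `{u, v}`, of a symmetric matrix `M`. -/
noncomputable def form (M : Matrix (Fin n) (Fin n) ℝ) (T : Tour n) : ℝ :=
  (∑ u, ∑ v, M u v * T.x s(u, v)) / 2

/-- A weighting of the edges of `K_n`, encoded as a symmetric matrix with zero diagonal, whose
weights at every vertex add up to zero. -/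
structure Balanced (M : Matrix (Fin n) (Fin n) ℝ) : Prop where
  symm : ∀ u v, M u v = M v u
  diag : ∀ u, M u u = 0
  row : ∀ u, ∑ v, M u v = 0

/-- The inner product of two edge weightings. -/
noncomputable def edgeInner (M N : Matrix (Fin n) (Fin n) ℝ) : ℝ := (∑ u, ∑ v, M u v * N u v) / 2

/-- The indicator of `u = a`. -/
def ind (a u : Fin n) : ℝ := if u = a then 1 else 0

lemma ind_self (a : Fin n) : ind a a = 1 := by simp [ind]

lemma ind_of_ne {a u : Fin n} (h : u ≠ a) : ind a u = 0 := by simp [ind, h]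

lemma sum_mul_ind (f : Fin n → ℝ) (a : Fin n) : ∑ u, f u * ind a u = f a := by simp [ind]

lemma sum_sum_mul_ind_ind (M : Matrix (Fin n) (Fin n) ℝ) (a b : Fin n) :
    ∑ u, ∑ v, M u v * (ind a u * ind b v) = M a b := by
  simp only [← mul_assoc, sum_mul_ind]

lemma Balanced.col {M : Matrix (Fin n) (Fin n) ℝ} (hM : Balanced M) (v : Fin n) :
    ∑ u, M u v = 0 := by
  rw [← hM.row v]; exact sum_congr rfl fun u _ => hM.symm u v

/-- Terms depending on one end only do not contribute to a sum against a balanced weighting. -/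
lemma Balanced.sum_mul_congr {M : Matrix (Fin n) (Fin n) ℝ} (hM : Balanced M)
    {g k : Fin n → Fin n → ℝ} {r r' : Fin n → ℝ}
    (h : ∀ u v, u ≠ v → g u v = r u + r' v + k u v) :
    ∑ u, ∑ v, M u v * g u v = ∑ u, ∑ v, M u v * k u v := by
  have h1 : ∀ u v, M u v * g u v = M u v * r u + M u v * r' v + M u v * k u v := by
    intro u v
    rcases eq_or_ne u v with rfl | huv
    · simp [hM.diag]
    · rw [h u v huv]; ring
  have h2 : ∑ u, ∑ v, M u v * r u = 0 := by
    simp [← sum_mul, hM.row]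
  have h3 : ∑ u, ∑ v, M u v * r' v = 0 := by
    rw [sum_comm]; simp [← sum_mul, hM.col]
  simp only [h1, sum_add_distrib, h2, h3, zero_add]

lemma avg_mul_form (G : Tour n → ℝ) (M : Matrix (Fin n) (Fin n) ℝ) :
    avg (fun T => G T * form M T) =
      (∑ u, ∑ v, M u v * avg (fun T => G T * T.x s(u, v))) / 2 := by
  have h : ∀ T, G T * form M T =
      (1 / 2 : ℝ) * ∑ u, ∑ v, M u v * (G T * T.x s(u, v)) := by
    intro T
    simp only [form, mul_left_comm _ (G T), ← mul_sum]
    ring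
  simp only [h, avg_const_mul, avg_sum]
  ring

lemma avg_x_mul_x (hn : 6 ≤ n) {a b u v : Fin n} (hab : a ≠ b) (huv : u ≠ v) :
    avg (fun T : Tour n => T.x s(a, b) * T.x s(u, v)) = 1 / ((n - 1) * (n - 2)) *
      (4 - 2 * (ind a u + ind b u) - 2 * (ind a v + ind b v) +
        2 * (n - 2) * (ind a u * ind b v + ind b u * ind a v)) := by
  have : (6 : ℝ) ≤ n := by exact_mod_cast hn
  have h1 : (n : ℝ) - 1 ≠ 0 := by linarith
  have h2 : (n : ℝ) - 2 ≠ 0 := by linarith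
  -- by symmetry it suffices to treat `u = a`
  have key : ∀ {a b v : Fin n}, a ≠ b → v ≠ a →
      avg (fun T : Tour n => T.x s(a, b) * T.x s(a, v)) = 1 / ((n - 1) * (n - 2)) *
      (4 - 2 * (ind a a + ind b a) - 2 * (ind a v + ind b v) +
        2 * (n - 2) * (ind a a * ind b v + ind b a * ind a v)) := by
    intro a b v hab hva
    rcases eq_or_ne v b with rfl | hvb
    · simp only [Tour.x_sq, avg_x (by omega : 3 ≤ n) hab, ind_self, ind_of_ne hva, ind_of_ne hab]
      field_simp
      ring
    · simp only [avg_x_adj (by omega : 4 ≤ n) hab hva.symm hvb.symm, ind_self, ind_of_ne hva,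
        ind_of_ne hab, ind_of_ne hvb]
      ring
  have key' : ∀ {u v : Fin n}, u ≠ v → u = a ∨ u = b →
      avg (fun T : Tour n => T.x s(a, b) * T.x s(u, v)) = 1 / ((n - 1) * (n - 2)) *
      (4 - 2 * (ind a u + ind b u) - 2 * (ind a v + ind b v) +
        2 * (n - 2) * (ind a u * ind b v + ind b u * ind a v)) := by
    rintro u v huv (rfl | rfl)
    · exact key hab huv.symm
    · rw [Sym2.eq_swap (a := a), key hab.symm huv.symm]; ring
  by_cases hu : u = a ∨ u = b
  · exact key' huv hu
  by_cases hv : v = a ∨ v = b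
  · rw [Sym2.eq_swap (a := u), key' huv.symm hv]; ring
  push Not at hu hv
  rw [avg_x_disj (by omega) hab hu.1.symm hv.1.symm hu.2.symm hv.2.symm huv, ind_of_ne hu.1,
    ind_of_ne hu.2, ind_of_ne hv.1, ind_of_ne hv.2]
  ring

lemma moment_self (a b c d : Fin n) :
    moment a b c d a b = avg fun T : Tour n => T.x s(a, b) * T.x s(c, d) := by
  unfold moment
  congr 1; funext T
  rw [mul_right_comm, T.x_sq]

/-- All triple moments whose first two edges are disjoint. -/
lemma moment_of_disjoint (hn : 6 ≤ n) {a b c d u v : Fin n} (hab : a ≠ b) (hac : a ≠ c)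
    (had : a ≠ d) (hbc : b ≠ c) (hbd : b ≠ d) (hcd : c ≠ d) (huv : u ≠ v) :
    moment a b c d u v = 1 / ((n - 1) * (n - 2) * (n - 3)) *
      (8 - 4 * (ind a u + ind b u + ind c u + ind d u) -
        4 * (ind a v + ind b v + ind c v + ind d v) +
        2 * ((ind a u + ind b u) * (ind c v + ind d v) +
          (ind c u + ind d u) * (ind a v + ind b v)) +
        4 * (n - 3) * (ind a u * ind b v + ind b u * ind a v +
          ind c u * ind d v + ind d u * ind c v)) := by
  have : (6 : ℝ) ≤ n := by exact_mod_cast hn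
  have h1 : (n : ℝ) - 1 ≠ 0 := by linarith
  have h2 : (n : ℝ) - 2 ≠ 0 := by linarith
  have h3 : (n : ℝ) - 3 ≠ 0 := by linarith
  -- by symmetry it suffices to treat `u = a`
  have key : ∀ {a b c d v : Fin n}, a ≠ b → a ≠ c → a ≠ d → b ≠ c → b ≠ d → c ≠ d → a ≠ v →
      moment a b c d a v = 1 / ((n - 1) * (n - 2) * (n - 3)) *
      (8 - 4 * (ind a a + ind b a + ind c a + ind d a) -
        4 * (ind a v + ind b v + ind c v + ind d v) +
        2 * ((ind a a + ind b a) * (ind c v + ind d v) +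
          (ind c a + ind d a) * (ind a v + ind b v)) +
        4 * (n - 3) * (ind a a * ind b v + ind b a * ind a v +
          ind c a * ind d v + ind d a * ind c v)) := by
    intro a b c d v hab hac had hbc hbd hcd hav
    simp only [ind_self, ind_of_ne hab, ind_of_ne hac, ind_of_ne had, ind_of_ne hav.symm]
    rcases eq_or_ne v b with rfl | hvb
    · simp only [moment_self, avg_x_disj (by omega : 4 ≤ n) hab hac had hbc hbd hcd, ind_self,
        ind_of_ne hbc, ind_of_ne hbd]
      field_simp
      ring
    have path : ∀ {c d : Fin n}, a ≠ c → a ≠ d → b ≠ c → b ≠ d → c ≠ d →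
        moment a b c d a c = 2 / ((n - 1) * (n - 2) * (n - 3)) := by
      intro c d hac had hbc hbd hcd
      rw [← moment_swap₁, ← moment_comm₂₃]
      exact moment_path hn hab.symm hbc hbd hac had hcd
    rcases eq_or_ne v c with rfl | hvc
    · rw [path hac had hbc hbd hcd]
      simp only [ind_self, ind_of_ne hvb, ind_of_ne hcd]
      ring
    rcases eq_or_ne v d with rfl | hvd
    · rw [← moment_swap₂, path had hac hbd hbc hcd.symm]
      simp only [ind_self, ind_of_ne hvb, ind_of_ne hvc]
      ring
    · rw [← moment_swap₁, ← moment_comm₂₃,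
        moment_path_edge hn hab.symm hvb.symm hbc hbd hav hac had hvc hvd hcd]
      simp only [ind_of_ne hvb, ind_of_ne hvc, ind_of_ne hvd]
      ring
  have key' : ∀ {u v : Fin n}, u ≠ v → u = a ∨ u = b ∨ u = c ∨ u = d →
      moment a b c d u v = 1 / ((n - 1) * (n - 2) * (n - 3)) *
      (8 - 4 * (ind a u + ind b u + ind c u + ind d u) -
        4 * (ind a v + ind b v + ind c v + ind d v) +
        2 * ((ind a u + ind b u) * (ind c v + ind d v) +
          (ind c u + ind d u) * (ind a v + ind b v)) +
        4 * (n - 3) * (ind a u * ind b v + ind b u * ind a v +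
          ind c u * ind d v + ind d u * ind c v)) := by
    rintro u v huv (rfl | rfl | rfl | rfl)
    · exact key hab hac had hbc hbd hcd huv
    · rw [← moment_swap₁, key hab.symm hbc hbd hac had hcd huv]; ring
    · rw [← moment_comm₁₂, key hcd hac.symm hbc.symm had.symm hbd.symm hab huv]; ring
    · rw [← moment_comm₁₂, ← moment_swap₁,
        key hcd.symm had.symm hbd.symm hac.symm hbc.symm hab huv]; ring
  by_cases hu : u = a ∨ u = b ∨ u = c ∨ u = d
  · exact key' huv hu
  by_cases hv : v = a ∨ v = b ∨ v = c ∨ v = d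
  · rw [← moment_swap₃, key' huv.symm hv]; ring
  push Not at hu hv
  obtain ⟨u1, u2, u3, u4⟩ := hu
  obtain ⟨v1, v2, v3, v4⟩ := hv
  rw [moment_matching hn hab hac had u1.symm v1.symm hbc hbd u2.symm v2.symm hcd u3.symm v3.symm
    u4.symm v4.symm huv]
  simp only [ind_of_ne u1, ind_of_ne u2, ind_of_ne u3, ind_of_ne u4, ind_of_ne v1, ind_of_ne v2,
    ind_of_ne v3, ind_of_ne v4]
  ring

/-- All triple moments whose first two edges share exactly one vertex. -/
lemma moment_of_adj (hn : 6 ≤ n) {a b c u v : Fin n} (hab : a ≠ b) (hac : a ≠ c) (hbc : b ≠ c)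
    (huv : u ≠ v) :
    moment a b a c u v = 1 / ((n - 1) * (n - 2) * (n - 3)) *
      (4 - (4 * ind a u + 2 * ind b u + 2 * ind c u) - (4 * ind a v + 2 * ind b v + 2 * ind c v) +
        2 * (n - 2) * (ind a u * ind b v + ind b u * ind a v +
          ind a u * ind c v + ind c u * ind a v)) := by
  have : (6 : ℝ) ≤ n := by exact_mod_cast hn
  have h1 : (n : ℝ) - 1 ≠ 0 := by linarith
  have h2 : (n : ℝ) - 2 ≠ 0 := by linarith
  have h3 : (n : ℝ) - 3 ≠ 0 := by linarith
  have self : ∀ {b c : Fin n}, a ≠ b → a ≠ c → b ≠ c →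
      moment a b a c a b = 2 / ((n - 1) * (n - 2)) := by
    intro b c hab hac hbc
    rw [moment_self, avg_x_adj (by omega) hab hac hbc]
  have key_b : ∀ {b c v : Fin n}, a ≠ b → a ≠ c → b ≠ c → b ≠ v →
      moment a b a c b v = 1 / ((n - 1) * (n - 2) * (n - 3)) *
      (4 - (4 * ind a b + 2 * ind b b + 2 * ind c b) - (4 * ind a v + 2 * ind b v + 2 * ind c v) +
        2 * (n - 2) * (ind a b * ind b v + ind b b * ind a v +
          ind a b * ind c v + ind c b * ind a v)) := by
    intro b c v hab hac hbc hbv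
    simp only [ind_self, ind_of_ne hab.symm, ind_of_ne hbc, ind_of_ne hbv.symm]
    rcases eq_or_ne v a with rfl | hva
    · rw [moment_swap₃, self hab hac hbc]
      simp only [ind_self, ind_of_ne hac]
      field_simp
      ring
    rcases eq_or_ne v c with rfl | hvc
    · rw [← moment_comm₂₃, moment_triangle (by omega) hab hac hbc]
      simp only [ind_self, ind_of_ne hac.symm]
      ring
    · rw [← moment_comm₁₂, ← moment_swap₁,
        moment_path hn hac.symm hbc.symm hvc.symm hab hva.symm hbv]
      simp only [ind_of_ne hva, ind_of_ne hvc]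
      ring
  have key' : ∀ {u v : Fin n}, u ≠ v → u = a ∨ u = b ∨ u = c →
      moment a b a c u v = 1 / ((n - 1) * (n - 2) * (n - 3)) *
      (4 - (4 * ind a u + 2 * ind b u + 2 * ind c u) - (4 * ind a v + 2 * ind b v + 2 * ind c v) +
        2 * (n - 2) * (ind a u * ind b v + ind b u * ind a v +
          ind a u * ind c v + ind c u * ind a v)) := by
    rintro u v huv (rfl | rfl | rfl)
    · simp only [ind_self, ind_of_ne hab, ind_of_ne hac, ind_of_ne huv.symm]
      rcases eq_or_ne v b with rfl | hvb
      · rw [self hab hac hbc]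
        simp only [ind_self, ind_of_ne hbc]
        field_simp
        ring
      rcases eq_or_ne v c with rfl | hvc
      · rw [← moment_comm₁₂, self hac hab hbc.symm]
        simp only [ind_self, ind_of_ne hbc.symm]
        field_simp
        ring
      · rw [moment_star hbc hvb.symm hvc.symm]
        simp only [ind_of_ne hvb, ind_of_ne hvc]
        ring
    · exact key_b hab hac hbc huv
    · rw [← moment_comm₁₂, key_b hac hab hbc.symm huv]; ring
  by_cases hu : u = a ∨ u = b ∨ u = c
  · exact key' huv hu
  by_cases hv : v = a ∨ v = b ∨ v = c
  · rw [← moment_swap₃, key' huv.symm hv]; ring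
  push Not at hu hv
  obtain ⟨u1, u2, u3⟩ := hu
  obtain ⟨v1, v2, v3⟩ := hv
  rw [← moment_swap₁, moment_path_edge hn hab.symm hbc u2.symm v2.symm hac u1.symm v1.symm u3.symm
    v3.symm huv]
  simp only [ind_of_ne u1, ind_of_ne u2, ind_of_ne u3, ind_of_ne v1, ind_of_ne v2, ind_of_ne v3]
  ring

/-- On balanced forms, the covariance with a coordinate is a multiple of the weight. -/
lemma avg_x_mul_form (hn : 6 ≤ n) {N : Matrix (Fin n) (Fin n) ℝ} (hN : Balanced N) {a b : Fin n}
    (hab : a ≠ b) : avg (fun T => T.x s(a, b) * form N T) = 2 / (n - 1) * N a b := by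
  have : (6 : ℝ) ≤ n := by exact_mod_cast hn
  have h1 : (n : ℝ) - 1 ≠ 0 := by linarith
  have h2 : (n : ℝ) - 2 ≠ 0 := by linarith
  rw [avg_mul_form, hN.sum_mul_congr
    (r := fun u => 1 / ((n - 1) * (n - 2)) * (4 - 2 * (ind a u + ind b u)))
    (r' := fun v => 1 / ((n - 1) * (n - 2)) * (- 2 * (ind a v + ind b v)))
    (k := fun u v => 2 / (n - 1) * (ind a u * ind b v + ind b u * ind a v))
    (fun u v huv => by rw [avg_x_mul_x hn hab huv]; field_simp; ring)]
  simp only [mul_left_comm _ (2 / ((n : ℝ) - 1)), ← mul_sum, mul_add, sum_add_distrib,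
    sum_sum_mul_ind_ind, hN.symm b a]
  ring

lemma avg_form (hn : 6 ≤ n) {N : Matrix (Fin n) (Fin n) ℝ} (hN : Balanced N) :
    avg (form N) = 0 := by
  have h := avg_mul_form (fun _ => 1) N
  simp only [one_mul] at h
  rw [h, hN.sum_mul_congr (r := fun _ => 2 / ((n : ℝ) - 1)) (r' := fun _ => 0) (k := fun _ _ => 0)
    (fun u v huv => by rw [avg_x (by omega) huv]; ring)]
  simp

lemma avg_form_mul_form (hn : 6 ≤ n) {M N : Matrix (Fin n) (Fin n) ℝ} (hM : Balanced M)
    (hN : Balanced N) : avg (fun T => form M T * form N T) = 2 / (n - 1) * edgeInner M N := by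
  have h : ∀ u v, M u v * avg (fun T => form N T * T.x s(u, v)) =
      2 / (n - 1) * (M u v * N u v) := by
    intro u v
    rcases eq_or_ne u v with rfl | huv
    · simp [hM.diag]
    · simp only [mul_comm (form N _), avg_x_mul_form hn hN huv]
      ring
  simp only [mul_comm (form M _)]
  rw [avg_mul_form]
  simp only [h, ← mul_sum, edgeInner]
  ring

lemma avg_x_mul_x_mul_form_of_disjoint (hn : 6 ≤ n) {N : Matrix (Fin n) (Fin n) ℝ}
    (hN : Balanced N) {a b c d : Fin n} (hab : a ≠ b) (hac : a ≠ c)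
    (had : a ≠ d) (hbc : b ≠ c) (hbd : b ≠ d) (hcd : c ≠ d) :
    avg (fun T => T.x s(a, b) * T.x s(c, d) * form N T) = 1 / ((n - 1) * (n - 2) * (n - 3)) *
      (2 * (N a c + N a d + N b c + N b d) + 4 * (n - 3) * (N a b + N c d)) := by
  rw [avg_mul_form]
  change (∑ u, ∑ v, N u v * moment a b c d u v) / 2 = _
  rw [hN.sum_mul_congr
    (r := fun u => 1 / ((n - 1) * (n - 2) * (n - 3)) *
      (8 - 4 * (ind a u + ind b u + ind c u + ind d u)))
    (r' := fun v => 1 / ((n - 1) * (n - 2) * (n - 3)) *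
      (- 4 * (ind a v + ind b v + ind c v + ind d v)))
    (k := fun u v => 1 / ((n - 1) * (n - 2) * (n - 3)) *
      (2 * (ind a u * ind c v + ind a u * ind d v + ind b u * ind c v + ind b u * ind d v +
          (ind c u * ind a v + ind c u * ind b v + ind d u * ind a v + ind d u * ind b v)) +
        4 * (n - 3) * (ind a u * ind b v + ind b u * ind a v +
          ind c u * ind d v + ind d u * ind c v)))
    (fun u v huv => (moment_of_disjoint hn hab hac had hbc hbd hcd huv).trans (by ring))]
  have e : ∀ u v, N u v * (1 / (((n : ℝ) - 1) * (n - 2) * (n - 3)) *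
      (2 * (ind a u * ind c v + ind a u * ind d v + ind b u * ind c v + ind b u * ind d v +
          (ind c u * ind a v + ind c u * ind b v + ind d u * ind a v + ind d u * ind b v)) +
        4 * (n - 3) * (ind a u * ind b v + ind b u * ind a v +
          ind c u * ind d v + ind d u * ind c v))) = 1 / (((n : ℝ) - 1) * (n - 2) * (n - 3)) *
      (2 * (N u v * (ind a u * ind c v) + N u v * (ind a u * ind d v) +
          N u v * (ind b u * ind c v) + N u v * (ind b u * ind d v) +
          (N u v * (ind c u * ind a v) + N u v * (ind c u * ind b v) +
            N u v * (ind d u * ind a v) + N u v * (ind d u * ind b v))) +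
        4 * (n - 3) * (N u v * (ind a u * ind b v) + N u v * (ind b u * ind a v) +
          N u v * (ind c u * ind d v) + N u v * (ind d u * ind c v))) := fun u v => by ring
  simp only [e, ← mul_sum, sum_add_distrib, sum_sum_mul_ind_ind]
  rw [hN.symm c a, hN.symm c b, hN.symm d a, hN.symm d b, hN.symm b a, hN.symm d c]
  ring

lemma avg_x_mul_x_mul_form_of_adj (hn : 6 ≤ n) {N : Matrix (Fin n) (Fin n) ℝ}
    (hN : Balanced N) {a b c : Fin n} (hab : a ≠ b) (hac : a ≠ c) (hbc : b ≠ c) :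
    avg (fun T => T.x s(a, b) * T.x s(a, c) * form N T) = 1 / ((n - 1) * (n - 2) * (n - 3)) *
      (2 * (n - 2) * (N a b + N a c)) := by
  rw [avg_mul_form]
  change (∑ u, ∑ v, N u v * moment a b a c u v) / 2 = _
  rw [hN.sum_mul_congr
    (r := fun u => 1 / ((n - 1) * (n - 2) * (n - 3)) *
      (4 - (4 * ind a u + 2 * ind b u + 2 * ind c u)))
    (r' := fun v => 1 / ((n - 1) * (n - 2) * (n - 3)) *
      (- (4 * ind a v + 2 * ind b v + 2 * ind c v)))
    (k := fun u v => 1 / ((n - 1) * (n - 2) * (n - 3)) *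
      (2 * (n - 2) * (ind a u * ind b v + ind b u * ind a v +
          ind a u * ind c v + ind c u * ind a v)))
    (fun u v huv => (moment_of_adj hn hab hac hbc huv).trans (by ring))]
  have e : ∀ u v, N u v * (1 / (((n : ℝ) - 1) * (n - 2) * (n - 3)) *
      (2 * (n - 2) * (ind a u * ind b v + ind b u * ind a v +
          ind a u * ind c v + ind c u * ind a v))) = 1 / (((n : ℝ) - 1) * (n - 2) * (n - 3)) *
      (2 * (n - 2) * (N u v * (ind a u * ind b v) + N u v * (ind b u * ind a v) +
          N u v * (ind a u * ind c v) + N u v * (ind c u * ind a v))) := fun u v => by ring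
  simp only [e, ← mul_sum, sum_add_distrib, sum_sum_mul_ind_ind]
  rw [hN.symm b a, hN.symm c a]
  ring

/-- The third moment `E[x_{ab} X_M X_N]` of two balanced forms: by invariance it is a
combination of the invariants of `M` and `N` relative to the edge `{a, b}`. -/
lemma avg_x_mul_form_mul_form (hn : 6 ≤ n) {M N : Matrix (Fin n) (Fin n) ℝ} (hM : Balanced M)
    (hN : Balanced N) {a b : Fin n} (hab : a ≠ b) :
    avg (fun T => T.x s(a, b) * form M T * form N T) = 1 / ((n - 1) * (n - 2) * (n - 3)) *
      (4 * (n - 3) * edgeInner M N - (2 * n - 6) * ((M * N) a a + (M * N) b b) -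
        2 * ((M * N) a b + (M * N) b a) + 2 * (n - 1) * (n - 4) * (M a b * N a b)) := by
  have : (6 : ℝ) ≤ n := by exact_mod_cast hn
  have h1 : (n : ℝ) - 1 ≠ 0 := by linarith
  have h2 : (n : ℝ) - 2 ≠ 0 := by linarith
  have h3 : (n : ℝ) - 3 ≠ 0 := by linarith
  -- `X`, `Y` correct the value for disjoint edges when the second edge contains `a` or `b`
  set X : Fin n → ℝ := fun v => -(2 * n - 6) * (N a b + N v a) - 2 * N v b with hX
  set Y : Fin n → ℝ := fun v => -(2 * n - 6) * (N a b + N v b) - 2 * N v a with hY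
  have key : ∀ u v, u ≠ v → avg (fun T => T.x s(a, b) * form N T * T.x s(u, v)) =
      1 / (((n : ℝ) - 1) * (n - 2) * (n - 3)) * (2 * (N a u + N b u) + 4 * (n - 3) * N a b) +
      1 / (((n : ℝ) - 1) * (n - 2) * (n - 3)) * (2 * (N a v + N b v)) +
      1 / (((n : ℝ) - 1) * (n - 2) * (n - 3)) * (4 * (n - 3) * N u v +
        (ind a u * X v + ind a v * X u + ind b u * Y v + ind b v * Y u) +
        2 * (n - 1) * (n - 4) * N a b * (ind a u * ind b v + ind b u * ind a v)) := by
    have base : ∀ u v, avg (fun T => T.x s(a, b) * form N T * T.x s(u, v)) =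
        avg (fun T => T.x s(a, b) * T.x s(u, v) * form N T) := fun u v => by
      congr 1; funext T; ring
    have hka : ∀ v, v ≠ a → v ≠ b → avg (fun T => T.x s(a, b) * form N T * T.x s(a, v)) =
        1 / ((n - 1) * (n - 2) * (n - 3)) * (2 * (n - 2) * (N a b + N a v)) := fun v ha hb => by
      rw [base, avg_x_mul_x_mul_form_of_adj hn hN hab ha.symm hb.symm]
    have hkb : ∀ v, v ≠ a → v ≠ b → avg (fun T => T.x s(a, b) * form N T * T.x s(b, v)) =
        1 / ((n - 1) * (n - 2) * (n - 3)) * (2 * (n - 2) * (N a b + N b v)) := fun v ha hb => by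
      rw [base, Sym2.eq_swap (a := a) (b := b),
        avg_x_mul_x_mul_form_of_adj hn hN hab.symm hb.symm ha.symm, hN.symm b a]
    have hkab : avg (fun T => T.x s(a, b) * form N T * T.x s(a, b)) = 2 / (n - 1) * N a b := by
      simp only [base, Tour.x_sq, avg_x_mul_form hn hN hab]
    intro u v huv
    rcases eq_or_ne u a with rfl | hua
    · rcases eq_or_ne v b with rfl | hvb
      · rw [hkab]
        simp only [hX, hY, ind_self, ind_of_ne hab, ind_of_ne hab.symm, hN.diag, hN.symm v u]
        field_simp
        ring
      · rw [hka v huv.symm hvb]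
        simp only [hX, hY, ind_self, ind_of_ne hab, ind_of_ne huv.symm, ind_of_ne hvb, hN.diag,
          hN.symm v u, hN.symm b u, hN.symm v b]
        ring
    rcases eq_or_ne u b with rfl | hub
    · rcases eq_or_ne v a with rfl | hva
      · rw [Sym2.eq_swap (a := u), hkab]
        simp only [hX, hY, ind_self, ind_of_ne hab, ind_of_ne hab.symm, hN.diag, hN.symm u v]
        field_simp
        ring
      · rw [hkb v hva huv.symm]
        simp only [hX, hY, ind_self, ind_of_ne hab.symm, ind_of_ne huv.symm, ind_of_ne hva, hN.diag,
          hN.symm v u, hN.symm u a, hN.symm v a]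
        ring
    rcases eq_or_ne v a with rfl | hva
    · rw [Sym2.eq_swap (a := u), hka u hua hub]
      simp only [hX, hY, ind_self, ind_of_ne hab, ind_of_ne hua, ind_of_ne hub, hN.diag,
          hN.symm u v, hN.symm b v, hN.symm u b]
      ring
    rcases eq_or_ne v b with rfl | hvb
    · rw [Sym2.eq_swap (a := u), hkb u hua hub]
      simp only [hX, hY, ind_self, ind_of_ne hab.symm, ind_of_ne hua, ind_of_ne hub, hN.diag,
          hN.symm u v, hN.symm v a, hN.symm u a]
      ring
    rw [base, avg_x_mul_x_mul_form_of_disjoint hn hN hab hua.symm hva.symm hub.symm hvb.symm huv]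
    simp only [ind_of_ne hua, ind_of_ne hub, ind_of_ne hva, ind_of_ne hvb]
    ring
  have hcomm : ∀ T, T.x s(a, b) * form M T * form N T = T.x s(a, b) * form N T * form M T :=
    fun T => by ring
  simp only [hcomm]
  rw [avg_mul_form, hM.sum_mul_congr key]
  have e : ∀ u v, M u v * (1 / (((n : ℝ) - 1) * (n - 2) * (n - 3)) * (4 * (n - 3) * N u v +
        (ind a u * X v + ind a v * X u + ind b u * Y v + ind b v * Y u) +
        2 * (n - 1) * (n - 4) * N a b * (ind a u * ind b v + ind b u * ind a v))) =
      1 / (((n : ℝ) - 1) * (n - 2) * (n - 3)) * (4 * (n - 3) * (M u v * N u v) +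
        ((M u v * X v) * ind a u + (M u v * X u) * ind a v + (M u v * Y v) * ind b u +
          (M u v * Y u) * ind b v) +
        2 * (n - 1) * (n - 4) * N a b * (M u v * (ind a u * ind b v) +
          M u v * (ind b u * ind a v))) := fun u v => by ring
  have e1 : ∀ (c : Fin n) (Z : Fin n → ℝ), ∑ u, ∑ v, M u v * Z v * ind c u = ∑ v, M c v * Z v := by
    intro c Z
    rw [sum_comm]
    simp only [sum_mul_ind]
  have e2 : ∀ (c : Fin n) (Z : Fin n → ℝ), ∑ u, ∑ v, M u v * Z u * ind c v = ∑ v, M c v * Z v := by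
    intro c Z
    simp only [sum_mul_ind]
    exact sum_congr rfl fun u _ => by rw [hM.symm]
  have e3 : ∀ c, ∑ v, M c v * X v = -(2 * n - 6) * (M * N) c a - 2 * (M * N) c b := by
    intro c
    have : ∀ v, M c v * X v = M c v * (-(2 * n - 6) * N a b) - (2 * n - 6) * (M c v * N v a) -
        2 * (M c v * N v b) := fun v => by rw [hX]; ring
    simp only [this, sum_sub_distrib, ← sum_mul, ← mul_sum, hM.row, Matrix.mul_apply]
    ring
  have e4 : ∀ c, ∑ v, M c v * Y v = -(2 * n - 6) * (M * N) c b - 2 * (M * N) c a := by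
    intro c
    have : ∀ v, M c v * Y v = M c v * (-(2 * n - 6) * N a b) - (2 * n - 6) * (M c v * N v b) -
        2 * (M c v * N v a) := fun v => by rw [hY]; ring
    simp only [this, sum_sub_distrib, ← sum_mul, ← mul_sum, hM.row, Matrix.mul_apply]
    ring
  simp only [e, ← mul_sum, sum_add_distrib, sum_sum_mul_ind_ind, e1, e2, e3, e4, hM.symm b a,
    edgeInner]
  ring

/-! ### The form matrix acting on edge weightings -/

/-- The vector of coefficients of the polynomial `z + ∑ M_{uv} x_{uv}`, the sum running over the
edges. It is defined for every matrix `M`, by symmetrisation, so as to be linear in `(z, M)`. -/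
noncomputable def coeffVec : ℝ × Matrix (Fin n) (Fin n) ℝ →ₗ[ℝ] (Option (Edge n) → ℝ) where
  toFun p i := i.elim p.1 fun e =>
    Sym2.lift ⟨fun u v => (p.2 u v + p.2 v u) / 2, fun u v => by dsimp only; rw [add_comm]⟩ e.1
  map_add' p q := by
    funext i
    rcases i with _ | ⟨e, he⟩
    · rfl
    · induction e using Sym2.ind with
      | _ u v => simp; ring
  map_smul' c p := by
    funext i
    rcases i with _ | ⟨e, he⟩
    · rfl
    · induction e using Sym2.ind with
      | _ u v => simp; ring

lemma coeffVec_none (p : ℝ × Matrix (Fin n) (Fin n) ℝ) : coeffVec p none = p.1 := rfl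

lemma coeffVec_some (p : ℝ × Matrix (Fin n) (Fin n) ℝ) (hp : ∀ u v, p.2 u v = p.2 v u)
    {u v : Fin n} (h : ¬ s(u, v).IsDiag) : coeffVec p (some ⟨s(u, v), h⟩) = p.2 u v := by
  change (p.2 u v + p.2 v u) / 2 = _
  rw [hp v u]; ring

lemma coeffVec_ext {x : Option (Edge n) → ℝ} {p : ℝ × Matrix (Fin n) (Fin n) ℝ}
    (hp : ∀ u v, p.2 u v = p.2 v u) (h0 : x none = p.1)
    (h1 : ∀ u v (h : u ≠ v), x (some ⟨s(u, v), by simpa using h⟩) = p.2 u v) :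
    x = coeffVec p := by
  funext i
  rcases i with _ | ⟨e, he⟩
  · exact h0
  · induction e using Sym2.ind with
    | _ u v =>
      have huv : u ≠ v := by simpa using he
      rw [coeffVec_some p hp he]
      exact h1 u v huv

/-- A sum over edges is half of the sum over ordered pairs. -/
lemma sum_edge (g : Sym2 (Fin n) → ℝ) (hg : ∀ u, g s(u, u) = 0) :
    ∑ e : Edge n, g e.1 = (∑ u, ∑ v, g s(u, v)) / 2 := by
  have h1 : ∑ e : Edge n, g e.1 = ∑ e with ¬ e.IsDiag, g e := by
    rw [← Finset.sum_subtype (Finset.univ.filter fun e : Sym2 (Fin n) => ¬ e.IsDiag) (by simp)]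
  have h2 := Finset.sum_sym2_filter_not_isDiag (univ : Finset (Fin n)) g
  rw [Finset.sym2_univ] at h2
  rw [h1, h2]
  have h3 : ∀ u v : Fin n, g s(u, v) = (if u < v then g s(u, v) else 0) +
      (if v < u then g s(v, u) else 0) := by
    intro u v
    rcases lt_trichotomy u v with h | rfl | h
    · simp [h, h.not_gt]
    · simp [hg]
    · simp [h, h.not_gt, Sym2.eq_swap]
  have h4 : ∑ u, ∑ v, g s(u, v) = 2 * ∑ u, ∑ v, if u < v then g s(u, v) else 0 := by
    rw [sum_congr rfl fun u _ => sum_congr rfl fun v _ => h3 u v]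
    simp only [sum_add_distrib]
    rw [sum_comm (f := fun u v => if v < u then g s(v, u) else 0)]
    ring
  rw [h4, ← Fintype.sum_prod_type' (f := fun u v : Fin n => if u < v then g s(u, v) else 0),
    ← sum_filter]
  rw [mul_div_cancel_left₀ _ two_ne_zero]
  refine sum_congr ?_ fun _ _ => rfl
  ext ⟨u, v⟩
  simp only [mem_filter, mem_offDiag, mem_univ, true_and]
  exact ⟨fun h => h.2, fun h => ⟨h.ne, h⟩⟩

lemma sum_coeffVec_mul_mono (p : ℝ × Matrix (Fin n) (Fin n) ℝ) (hp : ∀ u v, p.2 u v = p.2 v u)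
    (T : Tour n) :
    ∑ i, coeffVec p i * MvPolynomial.eval T.vec (mono i) = p.1 + form p.2 T := by
  rw [Fintype.sum_option]
  congr 1
  · simp [coeffVec_none, mono]
  · rw [form]
    have := sum_edge (fun e => Sym2.lift
      ⟨fun u v => (p.2 u v + p.2 v u) / 2, fun u v => by dsimp only; rw [add_comm]⟩ e * T.x e)
      (fun u => by simp [Tour.x_diag])
    simp only [mono, MvPolynomial.eval_X]
    refine this.trans ?_
    congr 1
    refine sum_congr rfl fun u _ => sum_congr rfl fun v _ => ?_
    simp only [Sym2.lift_mk, hp v u]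
    ring

lemma formMatrix_mulVec (f : Tour n → ℝ) (p : ℝ × Matrix (Fin n) (Fin n) ℝ)
    (hp : ∀ u v, p.2 u v = p.2 v u) (i : Option (Edge n)) :
    (formMatrix f).mulVec (coeffVec p) i =
      avg fun T => f T * MvPolynomial.eval T.vec (mono i) * (p.1 + form p.2 T) := by
  simp only [← sum_coeffVec_mul_mono p hp, mul_sum, avg_sum, Matrix.mulVec, dotProduct,
    formMatrix, Matrix.of_apply, ← avg_mul_const]
  refine sum_congr rfl fun j _ => ?_
  congr 1; funext T; ring

/-- The third moments `E[x_{ab} X_M X_N]` of balanced forms, see `avg_x_mul_form_mul_form`. -/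
noncomputable def thirdMoment (M N : Matrix (Fin n) (Fin n) ℝ) (a b : Fin n) : ℝ :=
  1 / ((n - 1) * (n - 2) * (n - 3)) *
      (4 * (n - 3) * edgeInner M N - (2 * n - 6) * ((M * N) a a + (M * N) b b) -
        2 * ((M * N) a b + (M * N) b a) + 2 * (n - 1) * (n - 4) * (M a b * N a b))

lemma form_add (M N : Matrix (Fin n) (Fin n) ℝ) (T : Tour n) :
    form (M + N) T = form M T + form N T := by
  simp only [form, Matrix.add_apply, add_mul, sum_add_distrib, add_div]

lemma form_smul (c : ℝ) (M : Matrix (Fin n) (Fin n) ℝ) (T : Tour n) :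
    form (c • M) T = c * form M T := by
  simp only [form, Matrix.smul_apply, smul_eq_mul, mul_assoc, ← mul_sum, mul_div_assoc]

/-- The row of the constant monomial in the product of the matrix of `1 + a X_F` with the
coefficient vector of a polynomial that agrees with `c + y X_M` on tours. -/
lemma formMatrix_mulVec_none (hn : 6 ≤ n) {F M : Matrix (Fin n) (Fin n) ℝ} (hF : Balanced F)
    (hM : Balanced M) (a c y : ℝ) (p : ℝ × Matrix (Fin n) (Fin n) ℝ)
    (hp : ∀ u v, p.2 u v = p.2 v u) (hc : ∀ T : Tour n, p.1 + form p.2 T = c + y * form M T) :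
    (formMatrix fun T => 1 + a * form F T).mulVec (coeffVec p) none =
      c + a * y * (2 / (n - 1) * edgeInner F M) := by
  rw [formMatrix_mulVec _ _ hp]
  have h : ∀ T : Tour n, (1 + a * form F T) * MvPolynomial.eval T.vec (mono none) *
      (p.1 + form p.2 T) =
      c + (a * c) * form F T + y * form M T + (a * y) * (form F T * form M T) := by
    intro T
    rw [hc]
    simp only [mono, map_one]
    ring
  simp only [h, avg_add, avg_const_mul, avg_const (by omega : 3 ≤ n), avg_form hn hF,
    avg_form hn hM, avg_form_mul_form hn hF hM]
  ring

/-- The row of `x_{uv}` in the product described at `formMatrix_mulVec_none`. -/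
lemma formMatrix_mulVec_some (hn : 6 ≤ n) {F M : Matrix (Fin n) (Fin n) ℝ} (hF : Balanced F)
    (hM : Balanced M) (a c y : ℝ) (p : ℝ × Matrix (Fin n) (Fin n) ℝ)
    (hp : ∀ u v, p.2 u v = p.2 v u) (hc : ∀ T : Tour n, p.1 + form p.2 T = c + y * form M T)
    (u v : Fin n) (huv : u ≠ v) :
    (formMatrix fun T => 1 + a * form F T).mulVec (coeffVec p)
        (some ⟨s(u, v), by simpa using huv⟩) =
      2 / (n - 1) * (c + a * c * F u v + y * M u v) + a * y * thirdMoment F M u v := by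
  rw [formMatrix_mulVec _ _ hp]
  have h : ∀ T : Tour n, (1 + a * form F T) *
      MvPolynomial.eval T.vec (mono (some ⟨s(u, v), by simpa using huv⟩)) * (p.1 + form p.2 T) =
      c * T.x s(u, v) + (a * c) * (T.x s(u, v) * form F T) + y * (T.x s(u, v) * form M T) +
        (a * y) * (T.x s(u, v) * form F T * form M T) := by
    intro T
    rw [hc]
    simp only [mono, MvPolynomial.eval_X, Tour.vec]
    ring
  simp only [h, avg_add, avg_const_mul, avg_x (by omega : 3 ≤ n) huv, avg_x_mul_form hn hF huv,
    avg_x_mul_form hn hM huv, avg_x_mul_form_mul_form hn hF hM huv, thirdMoment]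
  ring

/-- A balanced weighting orthogonal to `F` on which the third moments against `F` act as a scalar is
an eigenvector. -/
lemma formMatrix_mulVec_of_eigen (hn : 6 ≤ n) {F M : Matrix (Fin n) (Fin n) ℝ} (hF : Balanced F)
    (hM : Balanced M) (a μ : ℝ) (h0 : edgeInner F M = 0)
    (h : ∀ u v, u ≠ v → thirdMoment F M u v = μ * M u v) :
    (formMatrix fun T => 1 + a * form F T).mulVec (coeffVec (0, M)) =
      (2 / (n - 1) + a * μ) • coeffVec (0, M) := by
  rw [← map_smul]
  have hc : ∀ T : Tour n, (0 : ℝ) + form M T = 0 + 1 * form M T := fun T => by ring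
  refine coeffVec_ext (fun u v => by simp [hM.symm u v]) ?_ fun u v huv => ?_
  · rw [formMatrix_mulVec_none hn hF hM a 0 1 (0, M) hM.symm hc, h0]
    simp
  · rw [formMatrix_mulVec_some hn hF hM a 0 1 (0, M) hM.symm hc u v huv, h u v huv]
    simp only [Prod.smul_mk, Matrix.smul_apply, smul_eq_mul]
    ring

/-! ### The cut weighting -/

/-- The weight, on the edges inside a set of `m` of the `n` vertices, of the balanced weighting
`cutWeight` that represents the subtour function. -/
noncomputable def insideWeight (n m : ℝ) : ℝ := -(n - m) / ((n - 2) * (m - 1))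

/-- The balanced weighting that is constant inside `U`, inside its complement, and, with value
`1 / (n - 2)`, across the cut. On tours `h_U = 1 + ∑ (cutWeight U)_{uv} x_{uv}`. -/
noncomputable def cutWeight (U : Finset (Fin n)) : Matrix (Fin n) (Fin n) ℝ :=
  Matrix.of fun u v =>
    if u = v then 0
    else if u ∈ U then (if v ∈ U then insideWeight n #U else 1 / (n - 2))
    else (if v ∈ U then 1 / (n - 2) else insideWeight n (n - #U))

lemma cast_card_compl (U : Finset (Fin n)) : ((#Uᶜ : ℕ) : ℝ) = n - #U := by
  rw [card_compl, Fintype.card_fin, Nat.cast_sub (by simpa using card_le_univ U)]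

lemma cutWeight_compl (U : Finset (Fin n)) : cutWeight Uᶜ = cutWeight U := by
  ext u v
  simp only [cutWeight, Matrix.of_apply, mem_compl, cast_card_compl, sub_sub_cancel]
  split_ifs <;> simp_all

lemma cutWeight_symm (U : Finset (Fin n)) (u v : Fin n) : cutWeight U u v = cutWeight U v u := by
  simp only [cutWeight, Matrix.of_apply, eq_comm (a := u)]
  split_ifs <;> rfl

lemma sum_cutWeight_mul (U : Finset (Fin n)) {a : Fin n} (ha : a ∈ U) (k : Fin n → ℝ) :
    ∑ v, cutWeight U a v * k v =
      insideWeight n #U * (∑ v ∈ U, k v - k a) + 1 / (n - 2) * ∑ v ∈ Uᶜ, k v := by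
  rw [← sum_add_sum_compl U]
  congr 1
  · have : ∀ v ∈ U, cutWeight U a v * k v =
        insideWeight n #U * (k v - if a = v then k v else 0) := by
      intro v hv
      by_cases h : a = v <;> simp [cutWeight, ha, hv, h]
    rw [sum_congr rfl this, ← mul_sum, sum_sub_distrib, sum_ite_eq U a]
    simp [ha]
  · rw [mul_sum]
    refine sum_congr rfl fun v hv => ?_
    have hv' : v ∉ U := mem_compl.1 hv
    have : a ≠ v := fun h => hv' (h ▸ ha)
    simp [cutWeight, ha, hv', this]

lemma sum_cutWeight_mul' (U : Finset (Fin n)) {a : Fin n} (ha : a ∉ U) (k : Fin n → ℝ) :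
    ∑ v, cutWeight U a v * k v =
      insideWeight n (n - #U) * (∑ v ∈ Uᶜ, k v - k a) + 1 / (n - 2) * ∑ v ∈ U, k v := by
  have := sum_cutWeight_mul Uᶜ (mem_compl.2 ha) k
  rwa [cutWeight_compl, compl_compl, cast_card_compl] at this

lemma balanced_cutWeight (U : Finset (Fin n)) (h1 : 3 ≤ #U) (h2 : #U + 3 ≤ n) :
    Balanced (cutWeight U) where
  symm := cutWeight_symm U
  diag u := by simp [cutWeight]
  row u := by
    have e1 : (3 : ℝ) ≤ #U := by exact_mod_cast h1
    have e2 : (#U : ℝ) + 3 ≤ n := by exact_mod_cast h2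
    have e3 : (#U : ℝ) - 1 ≠ 0 := by linarith
    have e4 : (n : ℝ) - 2 ≠ 0 := by linarith
    have e5 : (n : ℝ) - #U - 1 ≠ 0 := by linarith
    by_cases hu : u ∈ U
    · have := sum_cutWeight_mul U hu fun _ => 1
      simp only [mul_one, sum_const, nsmul_eq_mul, cast_card_compl] at this
      rw [this, insideWeight]
      field_simp
      ring
    · have := sum_cutWeight_mul' U hu fun _ => 1
      simp only [mul_one, sum_const, nsmul_eq_mul, cast_card_compl] at this
      rw [this, insideWeight]
      field_simp
      ring

section Products

variable {M : Matrix (Fin n) (Fin n) ℝ}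

lemma Balanced.sum_compl (hM : Balanced M) (U : Finset (Fin n)) (b : Fin n) :
    ∑ v ∈ Uᶜ, M v b = -∑ v ∈ U, M v b := by
  rw [eq_neg_iff_add_eq_zero, add_comm, sum_add_sum_compl, hM.col]

lemma cutWeight_mul (hM : Balanced M) (U : Finset (Fin n)) {a : Fin n} (ha : a ∈ U) (b : Fin n) :
    (cutWeight U * M) a b = (insideWeight n #U - 1 / (n - 2)) * ∑ v ∈ U, M v b -
      insideWeight n #U * M a b := by
  rw [Matrix.mul_apply, sum_cutWeight_mul U ha (fun v => M v b), hM.sum_compl]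
  ring

lemma cutWeight_mul' (hM : Balanced M) (U : Finset (Fin n)) {a : Fin n} (ha : a ∉ U) (b : Fin n) :
    (cutWeight U * M) a b = (1 / (n - 2) - insideWeight n (n - #U)) * ∑ v ∈ U, M v b -
      insideWeight n (n - #U) * M a b := by
  rw [Matrix.mul_apply, sum_cutWeight_mul' U ha (fun v => M v b), hM.sum_compl]
  ring

lemma edgeInner_cutWeight (hM : Balanced M) (U : Finset (Fin n)) :
    edgeInner (cutWeight U) M =
      (insideWeight n #U - 2 / (n - 2) + insideWeight n (n - #U)) / 2 *
        ∑ a ∈ U, ∑ v ∈ U, M v a := by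
  have h : ∀ a, ∑ v, cutWeight U a v * M a v = (cutWeight U * M) a a := fun a => by
    rw [Matrix.mul_apply]; exact sum_congr rfl fun v _ => by rw [hM.symm a v]
  have hc : ∑ a ∈ Uᶜ, ∑ v ∈ U, M v a = - ∑ a ∈ U, ∑ v ∈ U, M v a := by
    rw [eq_neg_iff_add_eq_zero, add_comm, sum_add_sum_compl, sum_comm]
    exact sum_eq_zero fun v _ => hM.row v
  rw [edgeInner, sum_congr rfl fun a _ => h a, ← sum_add_sum_compl U,
    sum_congr rfl fun a ha => cutWeight_mul hM U ha a,
    sum_congr rfl fun a ha => cutWeight_mul' hM U (mem_compl.1 ha) a]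
  simp only [hM.diag, mul_zero, sub_zero, ← mul_sum, hc]
  ring

lemma thirdMoment_inside (hM : Balanced M) (U : Finset (Fin n)) {a b : Fin n} (ha : a ∈ U)
    (hb : b ∈ U) (hab : a ≠ b) : thirdMoment (cutWeight U) M a b =
      1 / ((n - 1) * (n - 2) * (n - 3)) * (4 * (n - 3) * edgeInner (cutWeight U) M -
        (2 * n - 4) * (insideWeight n #U - 1 / (n - 2)) * (∑ v ∈ U, M v a + ∑ v ∈ U, M v b) +
        2 * (n - 2) * (n - 3) * insideWeight n #U * M a b) := by
  rw [thirdMoment, cutWeight_mul hM U ha, cutWeight_mul hM U ha, cutWeight_mul hM U hb,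
    cutWeight_mul hM U hb, hM.diag, hM.diag, hM.symm b a,
    show cutWeight U a b = insideWeight n #U by simp [cutWeight, ha, hb, hab]]
  ring

lemma thirdMoment_across (hM : Balanced M) (U : Finset (Fin n)) {a b : Fin n} (ha : a ∈ U)
    (hb : b ∉ U) : thirdMoment (cutWeight U) M a b =
      1 / ((n - 1) * (n - 2) * (n - 3)) * (4 * (n - 3) * edgeInner (cutWeight U) M -
        (2 * n - 6) * ((insideWeight n #U - 1 / (n - 2)) * ∑ v ∈ U, M v a +
          (1 / (n - 2) - insideWeight n (n - #U)) * ∑ v ∈ U, M v b) -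
        2 * ((insideWeight n #U - 1 / (n - 2)) * ∑ v ∈ U, M v b +
          (1 / (n - 2) - insideWeight n (n - #U)) * ∑ v ∈ U, M v a) +
        2 * (insideWeight n #U + insideWeight n (n - #U) + (n - 1) * (n - 4) * (1 / (n - 2))) *
          M a b) := by
  have hab : a ≠ b := fun h => hb (h ▸ ha)
  rw [thirdMoment, cutWeight_mul hM U ha, cutWeight_mul hM U ha, cutWeight_mul' hM U hb,
    cutWeight_mul' hM U hb, hM.diag, hM.diag, hM.symm b a,
    show cutWeight U a b = 1 / ((n : ℝ) - 2) by simp [cutWeight, ha, hb, hab]]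
  ring

lemma thirdMoment_outside (hM : Balanced M) (U : Finset (Fin n)) {a b : Fin n} (ha : a ∉ U)
    (hb : b ∉ U) (hab : a ≠ b) : thirdMoment (cutWeight U) M a b =
      1 / ((n - 1) * (n - 2) * (n - 3)) * (4 * (n - 3) * edgeInner (cutWeight U) M -
        (2 * n - 4) * (1 / (n - 2) - insideWeight n (n - #U)) *
          (∑ v ∈ U, M v a + ∑ v ∈ U, M v b) +
        2 * (n - 2) * (n - 3) * insideWeight n (n - #U) * M a b) := by
  have h := thirdMoment_inside hM Uᶜ (mem_compl.2 ha) (mem_compl.2 hb) hab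
  rw [cutWeight_compl, cast_card_compl, hM.sum_compl, hM.sum_compl] at h
  rw [h]
  ring

lemma thirdMoment_symm (hM : Balanced M) {F : Matrix (Fin n) (Fin n) ℝ} (hF : Balanced F)
    (a b : Fin n) : thirdMoment F M a b = thirdMoment F M b a := by
  simp only [thirdMoment, hM.symm b a, hF.symm b a]
  ring

end Products

/-! ### Invariant subspaces of the form matrix -/

lemma Balanced.zero : Balanced (0 : Matrix (Fin n) (Fin n) ℝ) := ⟨by simp, by simp, by simp⟩

lemma Balanced.add {M N : Matrix (Fin n) (Fin n) ℝ} (hM : Balanced M) (hN : Balanced N) :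
    Balanced (M + N) where
  symm u v := by simp [hM.symm u v, hN.symm u v]
  diag u := by simp [hM.diag, hN.diag]
  row u := by simp [sum_add_distrib, hM.row, hN.row]

lemma Balanced.smul {M : Matrix (Fin n) (Fin n) ℝ} (hM : Balanced M) (c : ℝ) :
    Balanced (c • M) where
  symm u v := by simp [hM.symm u v]
  diag u := by simp [hM.diag]
  row u := by simp [← mul_sum, hM.row]

/-- The balanced weightings supported on the edges inside `U`. -/
def insideBlock (U : Finset (Fin n)) : Submodule ℝ (Matrix (Fin n) (Fin n) ℝ) where
  carrier := {M | Balanced M ∧ ∀ u v, ¬ (u ∈ U ∧ v ∈ U) → M u v = 0}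
  zero_mem' := ⟨.zero, by simp⟩
  add_mem' hM hN := ⟨hM.1.add hN.1, fun u v h => by simp [hM.2 u v h, hN.2 u v h]⟩
  smul_mem' c _ hM := ⟨hM.1.smul c, fun u v h => by simp [hM.2 u v h]⟩

/-- The balanced weightings supported on the edges between `U` and its complement. -/
def crossBlock (U : Finset (Fin n)) : Submodule ℝ (Matrix (Fin n) (Fin n) ℝ) where
  carrier := {M | Balanced M ∧ ∀ u v, (u ∈ U ↔ v ∈ U) → M u v = 0}
  zero_mem' := ⟨.zero, by simp⟩
  add_mem' hM hN := ⟨hM.1.add hN.1, fun u v h => by simp [hM.2 u v h, hN.2 u v h]⟩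
  smul_mem' c _ hM := ⟨hM.1.smul c, fun u v h => by simp [hM.2 u v h]⟩

/-- The vertex weightings supported on `U` with sum zero. -/
def stdSpace (U : Finset (Fin n)) : Submodule ℝ (Fin n → ℝ) where
  carrier := {φ | (∀ u, u ∉ U → φ u = 0) ∧ ∑ u, φ u = 0}
  zero_mem' := by simp
  add_mem' hφ hψ := ⟨fun u h => by simp [hφ.1 u h, hψ.1 u h], by
    simp [sum_add_distrib, hφ.2, hψ.2]⟩
  smul_mem' c _ hφ := ⟨fun u h => by simp [hφ.1 u h], by simp [← mul_sum, hφ.2]⟩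

/-- The balanced edge weighting made from a vertex weighting in `stdSpace U`: the sum of the weights
of the ends inside `U`, and a multiple of that sum, determined by balance, elsewhere. -/
noncomputable def stdMat (U : Finset (Fin n)) :
    (Fin n → ℝ) →ₗ[ℝ] Matrix (Fin n) (Fin n) ℝ where
  toFun φ := Matrix.of fun u v => if u = v then 0 else
    (φ u + φ v) * if u ∈ U ∧ v ∈ U then 1 else -((#U : ℝ) - 2) / (n - #U)
  map_add' φ ψ := by
    ext u v
    simp only [Matrix.of_apply, Matrix.add_apply, Pi.add_apply]
    split_ifs <;> ring
  map_smul' c φ := by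
    ext u v
    simp only [Matrix.of_apply, Matrix.smul_apply, Pi.smul_apply, smul_eq_mul, RingHom.id_apply]
    split_ifs <;> ring

/-- The edge weighting whose weights are the sums of the vertex weights of both ends. -/
noncomputable def vertexMat : (Fin n → ℝ) →ₗ[ℝ] Matrix (Fin n) (Fin n) ℝ where
  toFun ψ := Matrix.of fun u v => if u = v then 0 else ψ u + ψ v
  map_add' φ ψ := by
    ext u v
    simp only [Matrix.of_apply, Matrix.add_apply, Pi.add_apply]
    split_ifs <;> ring
  map_smul' c φ := by
    ext u v
    simp only [Matrix.of_apply, Matrix.smul_apply, Pi.smul_apply, smul_eq_mul, RingHom.id_apply]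
    split_ifs <;> ring

lemma stdMat_apply (U : Finset (Fin n)) (φ : Fin n → ℝ) (u v : Fin n) :
    stdMat U φ u v = if u = v then 0 else
      (φ u + φ v) * if u ∈ U ∧ v ∈ U then 1 else -((#U : ℝ) - 2) / (n - #U) := rfl

lemma vertexMat_apply (ψ : Fin n → ℝ) (u v : Fin n) :
    vertexMat ψ u v = if u = v then 0 else ψ u + ψ v := rfl

lemma stdMat_symm (U : Finset (Fin n)) (φ : Fin n → ℝ) (u v : Fin n) :
    stdMat U φ u v = stdMat U φ v u := by
  simp only [stdMat_apply, eq_comm (a := u), and_comm (a := u ∈ U), add_comm (φ u)]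

lemma vertexMat_symm (ψ : Fin n → ℝ) (u v : Fin n) : vertexMat ψ u v = vertexMat ψ v u := by
  simp only [vertexMat_apply, eq_comm (a := u), add_comm (ψ u)]

lemma sum_vertexMat (ψ : Fin n → ℝ) (u : Fin n) :
    ∑ v, vertexMat ψ u v = (n - 2) * ψ u + ∑ v, ψ v := by
  have : ∀ v, vertexMat ψ u v = ψ u + ψ v - if u = v then ψ u + ψ v else 0 := by
    intro v; rw [vertexMat_apply]; split_ifs <;> ring
  simp only [this, sum_sub_distrib, sum_add_distrib, sum_ite_eq, mem_univ, if_true, sum_const,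
    card_univ, Fintype.card_fin, nsmul_eq_mul]
  ring

/-- By the degree equations, `vertexMat ψ` represents a constant on the tours. -/
lemma form_vertexMat (ψ : Fin n → ℝ) (T : Tour n) : form (vertexMat ψ) T = 2 * ∑ v, ψ v := by
  have : ∀ u v, vertexMat ψ u v * T.x s(u, v) = ψ u * T.x s(u, v) + ψ v * T.x s(u, v) := by
    intro u v
    rw [vertexMat_apply]
    split_ifs with h
    · subst h; simp [T.x_diag]
    · ring
  have h2 : ∑ u, ∑ v, ψ v * T.x s(u, v) = ∑ u, ∑ v, ψ u * T.x s(u, v) := by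
    rw [sum_comm]; simp only [Sym2.eq_swap]
  simp only [form, this, sum_add_distrib]
  rw [h2]
  simp only [← mul_sum, T.sum_x, ← sum_mul]
  ring

section Std

variable {U : Finset (Fin n)} {φ : Fin n → ℝ}

lemma sum_of_mem_stdSpace (hφ : φ ∈ stdSpace U) : ∑ u ∈ U, φ u = 0 := by
  have h : ∑ u ∈ Uᶜ, φ u = 0 := sum_eq_zero fun u hu => hφ.1 u (mem_compl.1 hu)
  have := hφ.2
  rw [← sum_add_sum_compl U, h, add_zero] at this
  exact this

lemma stdMat_outside (hφ : φ ∈ stdSpace U) {u v : Fin n} (hu : u ∉ U) (hv : v ∉ U) :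
    stdMat U φ u v = 0 := by
  simp [stdMat_apply, hφ.1 u hu, hφ.1 v hv]

lemma stdMat_across (hφ : φ ∈ stdSpace U) {u v : Fin n} (hu : u ∈ U) (hv : v ∉ U) :
    stdMat U φ u v = -((#U : ℝ) - 2) / (n - #U) * φ u := by
  have : u ≠ v := fun h => hv (h ▸ hu)
  simp [stdMat_apply, hφ.1 v hv, hv, this, mul_comm]

lemma sum_stdMat (hφ : φ ∈ stdSpace U) (a : Fin n) :
    ∑ v ∈ U, stdMat U φ v a = ((#U : ℝ) - 2) * φ a := by
  by_cases ha : a ∈ U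
  · have : ∀ v ∈ U, stdMat U φ v a = φ v + φ a - if v = a then φ v + φ a else 0 := by
      intro v hv
      simp only [stdMat_apply, hv, ha, and_self, if_true, mul_one]
      split_ifs <;> ring
    rw [sum_congr rfl this, sum_sub_distrib, sum_add_distrib, sum_of_mem_stdSpace hφ,
      sum_ite_eq' U a, if_pos ha, sum_const, nsmul_eq_mul]
    ring
  · rw [sum_congr rfl fun v hv => stdMat_across hφ hv ha, ← mul_sum, sum_of_mem_stdSpace hφ,
      hφ.1 a ha]
    ring

lemma sum_compl_stdMat (hφ : φ ∈ stdSpace U) (hU : #U < n) (a : Fin n) :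
    ∑ v ∈ Uᶜ, stdMat U φ v a = -((#U : ℝ) - 2) * φ a := by
  by_cases ha : a ∈ U
  · rw [sum_congr rfl fun v hv =>
      (stdMat_symm U φ v a).trans (stdMat_across hφ ha (mem_compl.1 hv)), sum_const, nsmul_eq_mul,
      cast_card_compl]
    have : (#U : ℝ) < n := by exact_mod_cast hU
    have : (n : ℝ) - #U ≠ 0 := by linarith
    field_simp
  · rw [sum_congr rfl fun v hv => stdMat_outside hφ (mem_compl.1 hv) ha, hφ.1 a ha]
    simp

lemma balanced_stdMat (hφ : φ ∈ stdSpace U) (hU : #U < n) : Balanced (stdMat U φ) where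
  symm := stdMat_symm U φ
  diag u := by simp [stdMat_apply]
  row u := by
    simp only [stdMat_symm U φ u]
    rw [← sum_add_sum_compl U, sum_stdMat hφ, sum_compl_stdMat hφ hU]
    ring

end Std

section Eigen

variable {U : Finset (Fin n)}

/-- To verify an eigenvalue equation for the third moments against `cutWeight U`, it is enough to
consider edges inside, across, and outside `U`. -/
lemma forall_thirdMoment {M : Matrix (Fin n) (Fin n) ℝ} (hM : Balanced M) (h1 : 3 ≤ #U)
    (h2 : #U + 3 ≤ n) {G : Fin n → Fin n → ℝ} (hG : ∀ u v, G u v = G v u)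
    (hin : ∀ u ∈ U, ∀ v ∈ U, u ≠ v → thirdMoment (cutWeight U) M u v = G u v)
    (hcross : ∀ u ∈ U, ∀ v ∉ U, thirdMoment (cutWeight U) M u v = G u v)
    (hout : ∀ u ∉ U, ∀ v ∉ U, u ≠ v → thirdMoment (cutWeight U) M u v = G u v) (u v : Fin n)
    (huv : u ≠ v) : thirdMoment (cutWeight U) M u v = G u v := by
  by_cases hu : u ∈ U <;> by_cases hv : v ∈ U
  · exact hin u hu v hv huv
  · exact hcross u hu v hv
  · rw [thirdMoment_symm hM (balanced_cutWeight U h1 h2), hG]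
    exact hcross v hv u hu
  · exact hout u hu v hv huv

lemma formMatrix_mulVec_inside (h1 : 3 ≤ #U) (h2 : #U + 3 ≤ n) (a : ℝ)
    {M : Matrix (Fin n) (Fin n) ℝ} (hM : M ∈ insideBlock U) :
    (formMatrix fun T => 1 + a * form (cutWeight U) T).mulVec (coeffVec (0, M)) =
      (2 / (n - 1) + a * (2 / (n - 1) * insideWeight n #U)) • coeffVec (0, M) := by
  have hn : (6 : ℝ) ≤ n := by exact_mod_cast (by omega : 6 ≤ n)
  have e1 : (n : ℝ) - 1 ≠ 0 := by linarith
  have e2 : (n : ℝ) - 2 ≠ 0 := by linarith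
  have e3 : (n : ℝ) - 3 ≠ 0 := by linarith
  have hs : ∀ a, ∑ v ∈ U, M v a = 0 := by
    intro a
    rw [← hM.1.col a]
    exact sum_subset (subset_univ U) fun v _ hv => hM.2 v a fun h => hv h.1
  have hI : edgeInner (cutWeight U) M = 0 := by simp [edgeInner_cutWeight hM.1, hs]
  refine formMatrix_mulVec_of_eigen (by omega) (balanced_cutWeight U h1 h2) hM.1 a _ hI
    (forall_thirdMoment hM.1 h1 h2 (fun u v => by rw [hM.1.symm]) ?_ ?_ ?_)
  · intro u hu v hv huv
    rw [thirdMoment_inside hM.1 U hu hv huv, hI, hs, hs]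
    field_simp
    ring
  · intro u hu v hv
    rw [thirdMoment_across hM.1 U hu hv, hI, hs, hs, hM.2 u v fun h => hv h.2]
    ring
  · intro u hu v hv huv
    rw [thirdMoment_outside hM.1 U hu hv huv, hI, hs, hs, hM.2 u v fun h => hv h.2]
    ring

lemma formMatrix_mulVec_cross (h1 : 3 ≤ #U) (h2 : #U + 3 ≤ n) (a : ℝ)
    {M : Matrix (Fin n) (Fin n) ℝ} (hM : M ∈ crossBlock U) :
    (formMatrix fun T => 1 + a * form (cutWeight U) T).mulVec (coeffVec (0, M)) =
      (2 / (n - 1) + a * (2 / ((n - 1) * (n - 2) * (n - 3)) * (insideWeight n #U +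
        insideWeight n (n - #U) + (n - 1) * (n - 4) * (1 / (n - 2))))) • coeffVec (0, M) := by
  have hs : ∀ a, ∑ v ∈ U, M v a = 0 := by
    intro a
    by_cases ha : a ∈ U
    · exact sum_eq_zero fun v hv => hM.2 v a (by simp [ha, hv])
    · rw [← hM.1.col a]
      exact sum_subset (subset_univ U) fun v _ hv => hM.2 v a (by simp [ha, hv])
  have hI : edgeInner (cutWeight U) M = 0 := by simp [edgeInner_cutWeight hM.1, hs]
  refine formMatrix_mulVec_of_eigen (by omega) (balanced_cutWeight U h1 h2) hM.1 a _ hI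
    (forall_thirdMoment hM.1 h1 h2 (fun u v => by rw [hM.1.symm]) ?_ ?_ ?_)
  · intro u hu v hv huv
    rw [thirdMoment_inside hM.1 U hu hv huv, hI, hs, hs, hM.2 u v (by simp [hu, hv])]
    ring
  · intro u hu v hv
    rw [thirdMoment_across hM.1 U hu hv, hI, hs, hs]
    ring
  · intro u hu v hv huv
    rw [thirdMoment_outside hM.1 U hu hv huv, hI, hs, hs, hM.2 u v (by simp [hu, hv])]
    ring

lemma formMatrix_mulVec_std (h1 : 3 ≤ #U) (h2 : #U + 3 ≤ n) (a : ℝ)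
    {φ : Fin n → ℝ} (hφ : φ ∈ stdSpace U) :
    (formMatrix fun T => 1 + a * form (cutWeight U) T).mulVec (coeffVec (0, stdMat U φ)) =
      (2 / (n - 1) + a * (2 / ((n - 1) * (n - 3)) * ((n - 3) * insideWeight n #U -
        (#U - 2) * (insideWeight n #U - 1 / (n - 2))))) • coeffVec (0, stdMat U φ) := by
  have m1 : (3 : ℝ) ≤ #U := by exact_mod_cast h1
  have m2 : (#U : ℝ) + 3 ≤ n := by exact_mod_cast h2
  have e1 : (n : ℝ) - 1 ≠ 0 := by linarith
  have e2 : (n : ℝ) - 2 ≠ 0 := by linarith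
  have e3 : (n : ℝ) - 3 ≠ 0 := by linarith
  have e4 : (n : ℝ) - #U ≠ 0 := by linarith
  have e5 : (n : ℝ) - #U - 1 ≠ 0 := by linarith
  have e6 : (#U : ℝ) - 1 ≠ 0 := by linarith
  have hM := balanced_stdMat hφ (by omega)
  have hI : edgeInner (cutWeight U) (stdMat U φ) = 0 := by
    rw [edgeInner_cutWeight hM]
    simp only [sum_stdMat hφ, ← mul_sum, sum_of_mem_stdSpace hφ, mul_zero]
  refine formMatrix_mulVec_of_eigen (by omega) (balanced_cutWeight U h1 h2) hM a _ hI
    (forall_thirdMoment hM h1 h2 (fun u v => by rw [hM.symm]) ?_ ?_ ?_)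
  · intro u hu v hv huv
    rw [thirdMoment_inside hM U hu hv huv, hI, sum_stdMat hφ, sum_stdMat hφ]
    simp only [stdMat_apply, huv, hu, hv, if_false, and_self, if_true, mul_one]
    field_simp
    ring
  · intro u hu v hv
    rw [thirdMoment_across hM U hu hv, hI, sum_stdMat hφ, sum_stdMat hφ, hφ.1 v hv,
      stdMat_across hφ hu hv, insideWeight, insideWeight, sub_sub_cancel]
    field_simp
    ring
  · intro u hu v hv huv
    rw [thirdMoment_outside hM U hu hv huv, hI, sum_stdMat hφ, sum_stdMat hφ, hφ.1 v hv, hφ.1 u hu,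
      stdMat_outside hφ hu hv]
    ring

/-- The polynomials `∑ ψ_v (∑_u x_{uv} - 2)` vanish on all tours. -/
lemma formMatrix_mulVec_null (f : Tour n → ℝ) (ψ : Fin n → ℝ) :
    (formMatrix f).mulVec (coeffVec (-2 * ∑ v, ψ v, vertexMat ψ)) = 0 := by
  funext i
  rw [formMatrix_mulVec _ _ (vertexMat_symm ψ)]
  simp [form_vertexMat, avg]

lemma sum_cutWeight_inside {a : Fin n} (ha : a ∈ U) :
    ∑ v ∈ U, cutWeight U v a = insideWeight n #U * (#U - 1) := by
  have h := sum_cutWeight_mul U ha fun v => if v ∈ U then 1 else 0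
  have hc : ∑ v ∈ Uᶜ, (if v ∈ U then (1 : ℝ) else 0) = 0 :=
    sum_eq_zero fun v hv => by simp [mem_compl.1 hv]
  simp only [mul_ite, mul_one, mul_zero, sum_ite_mem, univ_inter, inter_self, hc, ha, if_true,
    sum_const, nsmul_eq_mul] at h
  simp only [cutWeight_symm U _ a, h]
  ring

lemma sum_cutWeight_outside {a : Fin n} (ha : a ∉ U) :
    ∑ v ∈ U, cutWeight U v a = 1 / (n - 2) * #U := by
  have h := sum_cutWeight_mul' U ha fun v => if v ∈ U then 1 else 0
  have hc : ∑ v ∈ Uᶜ, (if v ∈ U then (1 : ℝ) else 0) = 0 :=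
    sum_eq_zero fun v hv => by simp [mem_compl.1 hv]
  simp only [mul_ite, mul_one, mul_zero, sum_ite_mem, univ_inter, inter_self, hc, ha, if_false,
    sum_const, nsmul_eq_mul] at h
  simp only [cutWeight_symm U _ a, h]
  ring

lemma edgeInner_cutWeight_self (h1 : 3 ≤ #U) (h2 : #U + 3 ≤ n) :
    edgeInner (cutWeight U) (cutWeight U) =
      #U * (n - #U) * (n - 1) / (2 * ((#U - 1) * (n - #U - 1)) * (n - 2)) := by
  have m1 : (3 : ℝ) ≤ #U := by exact_mod_cast h1
  have m2 : (#U : ℝ) + 3 ≤ n := by exact_mod_cast h2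
  have e2 : (n : ℝ) - 2 ≠ 0 := by linarith
  have e5 : (n : ℝ) - #U - 1 ≠ 0 := by linarith
  have e6 : (#U : ℝ) - 1 ≠ 0 := by linarith
  rw [edgeInner_cutWeight (balanced_cutWeight U h1 h2),
    sum_congr rfl fun a ha => sum_cutWeight_inside ha, sum_const, nsmul_eq_mul, insideWeight,
    insideWeight, sub_sub_cancel]
  field_simp
  ring

/-- The edge `{a, b}` enters the third moment `E[x_{ab} X²]` of `X = h_U - 1` through its weight
only. -/
lemma thirdMoment_cutWeight_self (h1 : 3 ≤ #U) (h2 : #U + 3 ≤ n) (u v : Fin n) (huv : u ≠ v) :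
    thirdMoment (cutWeight U) (cutWeight U) u v =
      (2 / (n - 1)) ^ 2 * edgeInner (cutWeight U) (cutWeight U) +
        -2 * ((n ^ 2 - 1 - 4 * #U * (n - #U)) / ((n - 1) * (n - 3) * (#U - 1) * (n - #U - 1))) *
          cutWeight U u v := by
  have m1 : (3 : ℝ) ≤ #U := by exact_mod_cast h1
  have m2 : (#U : ℝ) + 3 ≤ n := by exact_mod_cast h2
  have e1 : (n : ℝ) - 1 ≠ 0 := by linarith
  have e2 : (n : ℝ) - 2 ≠ 0 := by linarith
  have e3 : (n : ℝ) - 3 ≠ 0 := by linarith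
  have e4 : (n : ℝ) - #U ≠ 0 := by linarith
  have e5 : (n : ℝ) - #U - 1 ≠ 0 := by linarith
  have e6 : (#U : ℝ) - 1 ≠ 0 := by linarith
  have hM := balanced_cutWeight U h1 h2
  refine forall_thirdMoment hM h1 h2 (G := fun u v =>
      (2 / (n - 1)) ^ 2 * edgeInner (cutWeight U) (cutWeight U) +
        -2 * ((n ^ 2 - 1 - 4 * #U * (n - #U)) / ((n - 1) * (n - 3) * (#U - 1) * (n - #U - 1))) *
          cutWeight U u v) (fun u v => by rw [cutWeight_symm]) ?_ ?_ ?_ u v huv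
  · intro u hu v hv huv
    rw [thirdMoment_inside hM U hu hv huv, sum_cutWeight_inside hu, sum_cutWeight_inside hv,
      edgeInner_cutWeight_self h1 h2,
      show cutWeight U u v = insideWeight n #U by simp [cutWeight, hu, hv, huv], insideWeight]
    field_simp
    ring
  · intro u hu v hv
    have huv : u ≠ v := fun h => hv (h ▸ hu)
    rw [thirdMoment_across hM U hu hv, sum_cutWeight_inside hu, sum_cutWeight_outside hv,
      edgeInner_cutWeight_self h1 h2,
      show cutWeight U u v = 1 / ((n : ℝ) - 2) by simp [cutWeight, hu, hv, huv], insideWeight,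
      insideWeight, sub_sub_cancel]
    field_simp
    ring
  · intro u hu v hv huv
    rw [thirdMoment_outside hM U hu hv huv, sum_cutWeight_outside hu, sum_cutWeight_outside hv,
      edgeInner_cutWeight_self h1 h2,
      show cutWeight U u v = insideWeight n (n - #U) by simp [cutWeight, hu, hv, huv],
      insideWeight, sub_sub_cancel]
    field_simp
    ring

/-- A polynomial invariant under the permutations preserving `U` and orthogonal to those vanishing
on all tours, in the coordinates `x 0`, its constant term, and `x 1`, the coefficient of
`cutWeight U`. -/
noncomputable def invariantPair (U : Finset (Fin n)) :
    (Fin 2 → ℝ) →ₗ[ℝ] ℝ × Matrix (Fin n) (Fin n) ℝ where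
  toFun x := (x 0, x 0 • vertexMat (fun _ => 1 / ((n : ℝ) - 1)) + x 1 • cutWeight U)
  map_add' x y := by
    ext <;> simp; ring
  map_smul' c x := by
    ext <;> simp; ring

/-- The action of the form matrix of `1 + a X`, `X = h_U - 1`, in the coordinates of
`invariantPair`. -/
noncomputable def invariantMatrix (U : Finset (Fin n)) (a : ℝ) : Matrix (Fin 2) (Fin 2) ℝ :=
  !![(3 * n - 1) / (n - 1), a * (2 / (n - 1) * edgeInner (cutWeight U) (cutWeight U));
    2 / (n - 1) * (a * ((3 * n - 1) / (n - 1))),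
    2 / (n - 1) - a * (2 * ((n ^ 2 - 1 - 4 * #U * (n - #U)) /
      ((n - 1) * (n - 3) * (#U - 1) * (n - #U - 1))))]

lemma formMatrix_mulVec_invariant (h1 : 3 ≤ #U) (h2 : #U + 3 ≤ n) (a : ℝ) (x : Fin 2 → ℝ) :
    (formMatrix fun T => 1 + a * form (cutWeight U) T).mulVec (coeffVec (invariantPair U x)) =
      coeffVec (invariantPair U ((invariantMatrix U a).mulVec x)) := by
  have hn : (6 : ℝ) ≤ n := by exact_mod_cast (by omega : 6 ≤ n)
  have e1 : (n : ℝ) - 1 ≠ 0 := by linarith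
  have hF := balanced_cutWeight U h1 h2
  have hsymm : ∀ x : Fin 2 → ℝ, ∀ u v, (invariantPair U x).2 u v = (invariantPair U x).2 v u := by
    intro x u v
    simp [invariantPair, vertexMat_symm _ u v, cutWeight_symm U u v]
  have hc : ∀ T : Tour n, (invariantPair U x).1 + form (invariantPair U x).2 T =
      (3 * n - 1) / (n - 1) * x 0 + x 1 * form (cutWeight U) T := by
    intro T
    simp only [invariantPair, LinearMap.coe_mk, AddHom.coe_mk, form_add, form_smul, form_vertexMat,
      sum_const, card_univ, Fintype.card_fin, nsmul_eq_mul]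
    field_simp
    ring
  refine coeffVec_ext (hsymm _) ?_ fun u v huv => ?_
  · rw [formMatrix_mulVec_none (by omega) hF hF a _ _ _ (hsymm x) hc]
    simp [invariantPair, invariantMatrix, dotProduct]
    ring
  · rw [formMatrix_mulVec_some (by omega) hF hF a _ _ _ (hsymm x) hc u v huv,
      thirdMoment_cutWeight_self h1 h2 u v huv]
    simp only [invariantPair, invariantMatrix, LinearMap.coe_mk, AddHom.coe_mk, Matrix.add_apply,
      Matrix.smul_apply, vertexMat_apply, huv, if_false, smul_eq_mul, Matrix.mulVec, dotProduct,
      Fin.sum_univ_two, Matrix.of_apply, Matrix.cons_val', Matrix.cons_val_zero,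
      Matrix.cons_val_one]
    ring

end Eigen

/-! ### The blocks decompose the coefficient space -/

lemma coeffVec_eq_zero {p : ℝ × Matrix (Fin n) (Fin n) ℝ} (hp : ∀ u v, p.2 u v = p.2 v u)
    (hd : ∀ u, p.2 u u = 0) (h : coeffVec p = 0) : p = 0 := by
  refine Prod.ext ?_ ?_
  · have := congrFun h none
    rwa [coeffVec_none] at this
  · ext u v
    rcases eq_or_ne u v with rfl | huv
    · simp [hd]
    · have := congrFun h (some ⟨s(u, v), by simpa using huv⟩)
      rwa [coeffVec_some p hp] at this

lemma blocks_independent {U : Finset (Fin n)} (h1 : 3 ≤ #U) (h2 : #U + 3 ≤ n) {ψ φ₁ φ₂ : Fin n → ℝ}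
    {M₁ M₂ M₃ : Matrix (Fin n) (Fin n) ℝ} {x : Fin 2 → ℝ} (hM₁ : M₁ ∈ insideBlock U)
    (hM₂ : M₂ ∈ insideBlock Uᶜ) (hM₃ : M₃ ∈ crossBlock U) (hφ₁ : φ₁ ∈ stdSpace U)
    (hφ₂ : φ₂ ∈ stdSpace Uᶜ)
    (h : coeffVec ((-2 * ∑ v, ψ v, vertexMat ψ) + (0, M₁) + (0, M₂) + (0, M₃) + (0, stdMat U φ₁) +
      (0, stdMat Uᶜ φ₂) + invariantPair U x) = 0) :
    ψ = 0 ∧ M₁ = 0 ∧ M₂ = 0 ∧ M₃ = 0 ∧ φ₁ = 0 ∧ φ₂ = 0 ∧ x = 0 := by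
  have m1 : (3 : ℝ) ≤ #U := by exact_mod_cast h1
  have m2 : (#U : ℝ) + 3 ≤ n := by exact_mod_cast h2
  have e1 : (n : ℝ) - 1 ≠ 0 := by linarith
  have e2 : (n : ℝ) - 2 ≠ 0 := by linarith
  have e4 : (n : ℝ) - #U ≠ 0 := by linarith
  have hcc : #Uᶜ < n := by rw [card_compl, Fintype.card_fin]; omega
  have hF := balanced_cutWeight U h1 h2
  have hS₁ := balanced_stdMat hφ₁ (by omega)
  have hS₂ := balanced_stdMat hφ₂ hcc
  have h0 := coeffVec_eq_zero (fun u v => by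
      simp [invariantPair, vertexMat_symm _ u v, hM₁.1.symm u v, hM₂.1.symm u v, hM₃.1.symm u v,
        hS₁.symm u v, hS₂.symm u v, hF.symm u v]) (fun u => by
      simp [invariantPair, vertexMat_apply, hM₁.1.diag, hM₂.1.diag, hM₃.1.diag, hS₁.diag, hS₂.diag,
        hF.diag]) h
  have hz : -2 * ∑ v, ψ v + x 0 = 0 := by
    have := congrArg Prod.fst h0
    simpa [invariantPair] using this
  have hent : ∀ u v, vertexMat ψ u v + M₁ u v + M₂ u v + M₃ u v + stdMat U φ₁ u v +
      stdMat Uᶜ φ₂ u v + (x 0 * vertexMat (fun _ => 1 / ((n : ℝ) - 1)) u v +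
        x 1 * cutWeight U u v) = 0 := by
    intro u v
    have := congrFun (congrFun (congrArg Prod.snd h0) u) v
    simpa [invariantPair] using this
  -- comparing row sums with the constant term isolates the polynomials that vanish on all tours
  have hrow : ∀ u, (n - 2) * ψ u + ∑ v, ψ v + x 0 * 2 = 0 := by
    intro u
    have := sum_eq_zero fun v (_ : v ∈ (univ : Finset (Fin n))) => hent u v
    simp only [sum_add_distrib, ← mul_sum, sum_vertexMat, hM₁.1.row, hM₂.1.row, hM₃.1.row, hS₁.row,
      hS₂.row, hF.row, sum_const, card_univ, Fintype.card_fin, nsmul_eq_mul] at this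
    have e : (n - 2) * (1 / ((n : ℝ) - 1)) + n * (1 / ((n : ℝ) - 1)) = 2 := by
      field_simp; ring
    rw [e] at this
    linarith
  have hψs : ∑ v, ψ v = 0 := by
    have := sum_eq_zero fun u (_ : u ∈ (univ : Finset (Fin n))) => hrow u
    simp only [sum_add_distrib, ← mul_sum, sum_const, card_univ, Fintype.card_fin,
      nsmul_eq_mul] at this
    have h6 : (6 * (n : ℝ) - 2) * ∑ v, ψ v = 0 := by
      linear_combination this - 2 * n * hz
    exact (mul_eq_zero.1 h6).resolve_left (by linarith)
  have hx0 : x 0 = 0 := by rw [hψs] at hz; linarith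
  have hψ : ψ = 0 := by
    funext u
    have := hrow u
    rw [hψs, hx0] at this
    have h6 : ((n : ℝ) - 2) * ψ u = 0 := by linarith
    exact (mul_eq_zero.1 h6).resolve_left e2
  subst hψ
  have hent2 : ∀ u v, M₁ u v + M₂ u v + M₃ u v + stdMat U φ₁ u v + stdMat Uᶜ φ₂ u v +
      x 1 * cutWeight U u v = 0 := by
    intro u v
    have := hent u v
    simp only [hx0, map_zero, Matrix.zero_apply] at this
    linarith
  -- the entries between `U` and its complement determine everything but `M₁` and `M₂`
  have hcross : ∀ u ∈ U, ∀ v ∉ U, M₃ u v + -((#U : ℝ) - 2) / (n - #U) * φ₁ u +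
      -((n : ℝ) - #U - 2) / #U * φ₂ v + x 1 * (1 / (n - 2)) = 0 := by
    intro u hu v hv
    have := hent2 u v
    have huv : u ≠ v := fun h => hv (h ▸ hu)
    rw [hM₁.2 u v fun h => hv h.2, hM₂.2 u v fun h => (mem_compl.1 h.1) hu,
      stdMat_across hφ₁ hu hv, stdMat_symm, stdMat_across hφ₂ (mem_compl.2 hv) (by simpa using hu),
      show cutWeight U u v = 1 / ((n : ℝ) - 2) by simp [cutWeight, hu, hv, huv],
      cast_card_compl, sub_sub_cancel] at this
    linarith
  have hM₃U : ∀ v, ∑ u ∈ U, M₃ u v = 0 := by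
    intro v
    by_cases hv : v ∈ U
    · exact sum_eq_zero fun u hu => hM₃.2 u v (by simp [hv, hu])
    · rw [← hM₃.1.col v]
      exact sum_subset (subset_univ U) fun u _ hu => hM₃.2 u v (by simp [hv, hu])
  have hsum : ∀ v ∉ U, #U * (-((n : ℝ) - #U - 2) / #U * φ₂ v + x 1 * (1 / (n - 2))) = 0 := by
    intro v hv
    have := sum_eq_zero fun u (hu : u ∈ U) => hcross u hu v hv
    simp only [sum_add_distrib, hM₃U, ← mul_sum, sum_of_mem_stdSpace hφ₁, sum_const,
      nsmul_eq_mul] at this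
    linarith
  have m0 : (#U : ℝ) ≠ 0 := by linarith
  have hsum' : ∀ v ∉ U, -((n : ℝ) - #U - 2) / #U * φ₂ v + x 1 * (1 / (n - 2)) = 0 :=
    fun v hv => (mul_eq_zero.1 (hsum v hv)).resolve_left m0
  have hx1 : x 1 = 0 := by
    have := sum_eq_zero fun v (hv : v ∈ Uᶜ) => hsum' v (mem_compl.1 hv)
    simp only [sum_add_distrib, ← mul_sum, sum_of_mem_stdSpace hφ₂, sum_const,
      nsmul_eq_mul, cast_card_compl, mul_zero, zero_add] at this
    exact (mul_eq_zero.1 this).resolve_right (mul_ne_zero e4 (one_div_ne_zero e2))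
  have hφ₂0 : φ₂ = 0 := by
    funext v
    by_cases hv : v ∈ U
    · exact hφ₂.1 v (by simpa using hv)
    · have := hsum' v hv
      rw [hx1, zero_mul, add_zero] at this
      exact (mul_eq_zero.1 this).resolve_left (div_ne_zero (by linarith) m0)
  subst hφ₂0
  have hφ₁0 : φ₁ = 0 := by
    funext u
    by_cases hu : u ∈ U
    · have := sum_eq_zero fun v (hv : v ∈ Uᶜ) => hcross u hu v (mem_compl.1 hv)
      have hc : ∑ v ∈ Uᶜ, M₃ u v = 0 := by
        simp only [hM₃.1.symm u]
        rw [hM₃.1.sum_compl, hM₃U, neg_zero]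
      simp only [sum_add_distrib, hc, hx1, Pi.zero_apply, mul_zero, zero_mul, add_zero, zero_add,
        sum_const, nsmul_eq_mul, cast_card_compl] at this
      have := (mul_eq_zero.1 this).resolve_left e4
      exact (mul_eq_zero.1 this).resolve_left (div_ne_zero (by linarith) e4)
    · exact hφ₁.1 u hu
  subst hφ₁0
  have hrest : ∀ u v, M₁ u v + M₂ u v + M₃ u v = 0 := by
    intro u v
    have := hent2 u v
    simp only [hx1, map_zero, Matrix.zero_apply] at this
    linarith
  have hz1 : M₁ = 0 := by
    ext u v
    by_cases huv : u ∈ U ∧ v ∈ U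
    · have := hrest u v
      rw [hM₂.2 u v (by simp [huv.1]), hM₃.2 u v (by simp [huv])] at this
      simpa using this
    · exact hM₁.2 u v huv
  have hz2 : M₂ = 0 := by
    ext u v
    by_cases huv : u ∈ Uᶜ ∧ v ∈ Uᶜ
    · have := hrest u v
      rw [hM₃.2 u v (by simp_all [mem_compl]), hz1] at this
      simpa using this
    · exact hM₂.2 u v huv
  refine ⟨rfl, hz1, hz2, ?_, rfl, rfl, ?_⟩
  · ext u v
    have := hrest u v
    rw [hz1, hz2] at this
    simpa using this
  · funext i; fin_cases i
    · exact hx0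
    · exact hx1

/-! ### Dimensions of the blocks -/

/-- The symmetric matrix with zero diagonal of a function on edges. -/
noncomputable def edgeMat : (Edge n → ℝ) →ₗ[ℝ] Matrix (Fin n) (Fin n) ℝ where
  toFun c := Matrix.of fun u v => if h : u = v then 0 else c ⟨s(u, v), by simpa using h⟩
  map_add' c d := by
    ext u v
    simp only [Matrix.of_apply, Matrix.add_apply, Pi.add_apply]
    split_ifs <;> simp
  map_smul' r c := by
    ext u v
    simp only [Matrix.of_apply, Matrix.smul_apply, Pi.smul_apply, smul_eq_mul, RingHom.id_apply]
    split_ifs <;> simp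

lemma edgeMat_apply (c : Edge n → ℝ) (u v : Fin n) :
    edgeMat c u v = if h : u = v then 0 else c ⟨s(u, v), by simpa using h⟩ := rfl

lemma edgeMat_diag (c : Edge n → ℝ) (u : Fin n) : edgeMat c u u = 0 := by simp [edgeMat_apply]

lemma edgeMat_symm (c : Edge n → ℝ) (u v : Fin n) : edgeMat c u v = edgeMat c v u := by
  simp only [edgeMat_apply, eq_comm (a := u), Sym2.eq_swap (a := u)]

lemma edgeMat_injective : Function.Injective (edgeMat (n := n)) := by
  intro c d h
  funext ⟨e, he⟩
  induction e using Sym2.ind with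
  | _ u v =>
    have huv : u ≠ v := by simpa using he
    have := congrFun (congrFun h u) v
    simpa [edgeMat_apply, huv] using this

/-- A space of weightings that contains all solutions of `r` linear conditions on edge functions
has codimension at most `r` in the space of edge functions. -/
lemma card_edge_le_finrank_add (W : Submodule ℝ (Matrix (Fin n) (Fin n) ℝ)) {K : Type*}
    [AddCommGroup K] [Module ℝ K] [FiniteDimensional ℝ K] (L : (Edge n → ℝ) →ₗ[ℝ] K)
    (h : ∀ c, L c = 0 → edgeMat c ∈ W) :
    Fintype.card (Edge n) ≤ Module.finrank ℝ W + Module.finrank ℝ K := by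
  have h1 := L.finrank_range_add_finrank_ker
  rw [Module.finrank_fintype_fun_eq_card] at h1
  have h2 : Module.finrank ℝ (LinearMap.range L) ≤ Module.finrank ℝ K := Submodule.finrank_le _
  have h3 : Module.finrank ℝ (LinearMap.ker L) ≤ Module.finrank ℝ W := by
    rw [(Submodule.equivMapOfInjective _ edgeMat_injective (LinearMap.ker L)).finrank_eq]
    refine Submodule.finrank_mono ?_
    rintro _ ⟨c, hc, rfl⟩
    exact h c hc
  omega

/-- The linear map taking a matrix to its row sums. -/
def rowSums : Matrix (Fin n) (Fin n) ℝ →ₗ[ℝ] (Fin n → ℝ) where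
  toFun M u := ∑ v, M u v
  map_add' M N := by ext u; simp [sum_add_distrib]
  map_smul' c M := by ext u; simp [mul_sum]

lemma two_mul_card_edge (p : Sym2 (Fin n) → Prop) [DecidablePred p] :
    2 * (Fintype.card {e : Edge n // p e.1} : ℝ) =
      ∑ u, ∑ v, if u ≠ v ∧ p s(u, v) then (1 : ℝ) else 0 := by
  have h := sum_edge (fun e : Sym2 (Fin n) => if ¬ e.IsDiag ∧ p e then (1 : ℝ) else 0)
    (fun u => by simp)
  have h2 : ∑ e : Edge n, (if ¬ e.1.IsDiag ∧ p e.1 then (1 : ℝ) else 0) =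
      Fintype.card {e : Edge n // p e.1} := by
    rw [Fintype.card_subtype, card_filter, Nat.cast_sum]
    exact sum_congr rfl fun e _ => by simp [e.2]
  rw [h2] at h
  rw [h]
  simp only [Sym2.mk_isDiag_iff, ne_eq]
  ring

lemma two_mul_card_inside (U : Finset (Fin n)) :
    2 * Fintype.card {e : Edge n // e.1 ∈ U.sym2} + #U = #U * #U := by
  have h := two_mul_card_edge (n := n) (fun e => e ∈ U.sym2)
  have h2 : ∀ u v : Fin n, (if u ≠ v ∧ s(u, v) ∈ U.sym2 then (1 : ℝ) else 0) =
      (if u ∈ U then 1 else 0) * (if v ∈ U then 1 else 0) -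
        (if u = v then (if u ∈ U then 1 else 0) else 0) := by
    intro u v
    simp only [mk_mem_sym2_iff]
    split_ifs <;> simp_all
  simp only [h2, sum_sub_distrib, ← mul_sum, ← sum_mul, sum_ite_eq, mem_univ, if_true, sum_ite_mem,
    univ_inter, sum_const, nsmul_eq_mul, mul_one] at h
  have : (2 * Fintype.card {e : Edge n // e.1 ∈ U.sym2} + #U : ℝ) = #U * #U := by linarith
  exact_mod_cast this

lemma card_cross (U : Finset (Fin n)) :
    Fintype.card {e : Edge n // e.1 ∉ U.sym2 ∧ e.1 ∉ Uᶜ.sym2} = #U * #Uᶜ := by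
  have h := two_mul_card_edge (n := n) (fun e => e ∉ U.sym2 ∧ e ∉ Uᶜ.sym2)
  have h2 : ∀ u v : Fin n, (if u ≠ v ∧ s(u, v) ∉ U.sym2 ∧ s(u, v) ∉ Uᶜ.sym2 then (1 : ℝ) else 0) =
      (if u ∈ U then 1 else 0) * (if v ∈ Uᶜ then 1 else 0) +
        (if u ∈ Uᶜ then 1 else 0) * (if v ∈ U then 1 else 0) := by
    intro u v
    simp only [mk_mem_sym2_iff, mem_compl]
    split_ifs <;> simp_all
  simp only [h2, sum_add_distrib, ← mul_sum, ← sum_mul, sum_ite_mem, univ_inter, sum_const,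
    nsmul_eq_mul, mul_one] at h
  have : (Fintype.card {e : Edge n // e.1 ∉ U.sym2 ∧ e.1 ∉ Uᶜ.sym2} : ℝ) = #U * #Uᶜ := by linarith
  exact_mod_cast this

lemma card_edge_add : 2 * Fintype.card (Edge n) + n = n * n := by
  have h := two_mul_card_inside (univ : Finset (Fin n))
  rw [card_univ, Fintype.card_fin] at h
  have : Fintype.card {e : Edge n // e.1 ∈ (univ : Finset (Fin n)).sym2} =
      Fintype.card (Edge n) := by
    rw [Fintype.card_subtype]
    simp
  rwa [this] at h

lemma card_inside_le (U : Finset (Fin n)) :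
    Fintype.card {e : Edge n // e.1 ∈ U.sym2} ≤ Module.finrank ℝ (insideBlock U) + #U := by
  have h := card_edge_le_finrank_add (insideBlock U)
    ((LinearMap.funLeft ℝ ℝ (Subtype.val : {e : Edge n // ¬ e.1 ∈ U.sym2} → Edge n)).prod
      (LinearMap.funLeft ℝ ℝ (Subtype.val : U → Fin n) ∘ₗ rowSums ∘ₗ edgeMat)) (by
    intro c hc
    have hc1 : ∀ e : Edge n, e.1 ∉ U.sym2 → c e = 0 := fun e he =>
      congrFun (congrArg Prod.fst hc) ⟨e, he⟩
    have hc2 : ∀ u ∈ U, ∑ v, edgeMat c u v = 0 := fun u hu =>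
      congrFun (congrArg Prod.snd hc) ⟨u, hu⟩
    have hs : ∀ u v, ¬ (u ∈ U ∧ v ∈ U) → edgeMat c u v = 0 := by
      intro u v huv
      rw [edgeMat_apply]
      split_ifs with h
      · rfl
      · exact hc1 _ (by simpa using huv)
    refine ⟨⟨edgeMat_symm c, edgeMat_diag c, fun u => ?_⟩, hs⟩
    by_cases hu : u ∈ U
    · exact hc2 u hu
    · exact sum_eq_zero fun v _ => hs u v fun h => hu h.1)
  rw [Module.finrank_prod, Module.finrank_fintype_fun_eq_card, Module.finrank_fintype_fun_eq_card,
    Fintype.card_subtype_compl fun e : Edge n => e.1 ∈ U.sym2, Fintype.card_coe] at h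
  have := Fintype.card_subtype_le fun e : Edge n => e.1 ∈ U.sym2
  omega

/-- The row sums of a weighting supported on the cut satisfy a linear relation, so one of the
vertex conditions is redundant. -/
lemma card_cross_le {U : Finset (Fin n)} {u₀ : Fin n} (hu₀ : u₀ ∈ U) :
    #U * #Uᶜ + 1 ≤ Module.finrank ℝ (crossBlock U) + n := by
  have h := card_edge_le_finrank_add (crossBlock U)
    ((LinearMap.funLeft ℝ ℝ
        (Subtype.val : {e : Edge n // ¬ (e.1 ∉ U.sym2 ∧ e.1 ∉ Uᶜ.sym2)} → Edge n)).prod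
      (LinearMap.funLeft ℝ ℝ (Subtype.val : {v : Fin n // ¬ v = u₀} → Fin n) ∘ₗ
        rowSums ∘ₗ edgeMat)) (by
    intro c hc
    have hc1 : ∀ e : Edge n, ¬ (e.1 ∉ U.sym2 ∧ e.1 ∉ Uᶜ.sym2) → c e = 0 := fun e he =>
      congrFun (congrArg Prod.fst hc) ⟨e, he⟩
    have hc2 : ∀ u ≠ u₀, ∑ v, edgeMat c u v = 0 := fun u hu =>
      congrFun (congrArg Prod.snd hc) ⟨u, hu⟩
    have hs : ∀ u v, (u ∈ U ↔ v ∈ U) → edgeMat c u v = 0 := by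
      intro u v huv
      rw [edgeMat_apply]
      split_ifs with h
      · rfl
      · refine hc1 _ ?_
        simp only [mk_mem_sym2_iff, mem_compl]
        tauto
    have hU : ∑ u ∈ U, ∑ v, edgeMat c u v = 0 := by
      have e1 : ∀ u ∈ U, ∑ v, edgeMat c u v = ∑ v ∈ Uᶜ, edgeMat c u v := by
        intro u hu
        refine (sum_subset (subset_univ _) fun v _ hv => hs u v ?_).symm
        simp_all
      have e2 : ∀ v ∈ Uᶜ, ∑ u ∈ U, edgeMat c u v = 0 := by
        intro v hv
        rw [← hc2 v (by rintro rfl; exact (mem_compl.1 hv) hu₀)]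
        simp only [edgeMat_symm c v]
        refine sum_subset (subset_univ _) fun u _ hu => hs u v ?_
        simp_all
      exact (sum_congr rfl e1).trans
        ((sum_comm (f := fun u v => edgeMat c u v)).trans (sum_eq_zero e2))
    have h0 : ∑ v, edgeMat c u₀ v = 0 := by
      rw [← add_sum_erase U _ hu₀, sum_eq_zero fun u hu => hc2 u (ne_of_mem_erase hu),
        add_zero] at hU
      exact hU
    refine ⟨⟨edgeMat_symm c, edgeMat_diag c, fun u => ?_⟩, hs⟩
    by_cases hu : u = u₀
    · rw [hu, h0]
    · exact hc2 u hu)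
  rw [Module.finrank_prod, Module.finrank_fintype_fun_eq_card, Module.finrank_fintype_fun_eq_card,
    Fintype.card_subtype_compl fun e : Edge n => e.1 ∉ U.sym2 ∧ e.1 ∉ Uᶜ.sym2,
    Fintype.card_subtype_compl fun v => v = u₀, card_cross, Fintype.card_fin,
    Fintype.card_subtype_eq] at h
  have h1 := Fintype.card_subtype_le fun e : Edge n => e.1 ∉ U.sym2 ∧ e.1 ∉ Uᶜ.sym2
  rw [card_cross] at h1
  have := u₀.pos
  omega

lemma card_le_finrank_stdSpace (U : Finset (Fin n)) :
    #U ≤ Module.finrank ℝ (stdSpace U) + 1 := by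
  set L := (LinearMap.funLeft ℝ ℝ (Subtype.val : {v : Fin n // ¬ v ∈ U} → Fin n)).prod
    (Fintype.linearCombination ℝ fun _ : Fin n => (1 : ℝ)) with hL
  have h1 := L.finrank_range_add_finrank_ker
  have h2 := Submodule.finrank_le (LinearMap.range L)
  have h3 : LinearMap.ker L ≤ stdSpace U := by
    intro φ hφ
    refine ⟨fun u hu => congrFun (congrArg Prod.fst hφ) ⟨u, hu⟩, ?_⟩
    have := congrArg Prod.snd hφ
    simpa [hL, Fintype.linearCombination_apply] using this
  have h4 := Submodule.finrank_mono h3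
  rw [Module.finrank_fintype_fun_eq_card, Fintype.card_fin] at h1
  rw [Module.finrank_prod, Module.finrank_fintype_fun_eq_card, Fintype.card_subtype_compl,
    Fintype.card_coe, Fintype.card_fin, Module.finrank_self] at h2
  have := card_le_univ U
  rw [Fintype.card_fin] at this
  omega

/-! ### The characteristic polynomial -/

/-- The block decomposition of the space of coefficient vectors: polynomials vanishing on all
tours, the five types of non-invariant blocks, and the invariant polynomials orthogonal to those
vanishing on all tours. -/
noncomputable def blockMap (U : Finset (Fin n)) :
    ((((((Fin n → ℝ) × insideBlock U) × insideBlock Uᶜ) × crossBlock U) × stdSpace U) ×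
      stdSpace Uᶜ) × (Fin 2 → ℝ) →ₗ[ℝ] (Option (Edge n) → ℝ) :=
  coeffVec ∘ₗ (((((((((-2 : ℝ) • ∑ v, LinearMap.proj v).prod vertexMat).coprod
    (LinearMap.inr ℝ ℝ _ ∘ₗ (insideBlock U).subtype)).coprod
    (LinearMap.inr ℝ ℝ _ ∘ₗ (insideBlock Uᶜ).subtype)).coprod
    (LinearMap.inr ℝ ℝ _ ∘ₗ (crossBlock U).subtype)).coprod
    (LinearMap.inr ℝ ℝ _ ∘ₗ stdMat U ∘ₗ (stdSpace U).subtype)).coprod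
    (LinearMap.inr ℝ ℝ _ ∘ₗ stdMat Uᶜ ∘ₗ (stdSpace Uᶜ).subtype)).coprod (invariantPair U))

lemma blockMap_apply (U : Finset (Fin n)) (p : ((((((Fin n → ℝ) × insideBlock U) ×
    insideBlock Uᶜ) × crossBlock U) × stdSpace U) × stdSpace Uᶜ) × (Fin 2 → ℝ)) :
    blockMap U p = coeffVec ((-2 * ∑ v, p.1.1.1.1.1.1 v, vertexMat p.1.1.1.1.1.1) +
      (0, p.1.1.1.1.1.2.1) + (0, p.1.1.1.1.2.1) + (0, p.1.1.1.2.1) + (0, stdMat U p.1.1.2.1) +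
      (0, stdMat Uᶜ p.1.2.1) + invariantPair U p.2) := by
  simp [blockMap]

lemma blockMap_injective {U : Finset (Fin n)} (h1 : 3 ≤ #U) (h2 : #U + 3 ≤ n) :
    Function.Injective (blockMap U) := by
  rw [← LinearMap.ker_eq_bot, LinearMap.ker_eq_bot']
  intro p hp
  rw [blockMap_apply] at hp
  obtain ⟨e1, e2, e3, e4, e5, e6, e7⟩ := blocks_independent h1 h2 p.1.1.1.1.1.2.2 p.1.1.1.1.2.2
    p.1.1.1.2.2 p.1.1.2.2 p.1.2.2 hp
  obtain ⟨⟨⟨⟨⟨⟨p1, p2⟩, p3⟩, p4⟩, p5⟩, p6⟩, p7⟩ := p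
  simp only [Prod.mk_eq_zero]
  exact ⟨⟨⟨⟨⟨⟨e1, Subtype.ext e2⟩, Subtype.ext e3⟩, Subtype.ext e4⟩, Subtype.ext e5⟩,
    Subtype.ext e6⟩, e7⟩

/-- The lower bounds for the dimensions of the blocks add up to the dimension of the whole space,
so all of them are attained and the blocks span. -/
lemma finrank_blocks {U : Finset (Fin n)} (h1 : 3 ≤ #U) (h2 : #U + 3 ≤ n) :
    finrank ℝ (insideBlock U) = #U * (#U - 3) / 2 ∧
    finrank ℝ (insideBlock Uᶜ) = (n - #U) * (n - #U - 3) / 2 ∧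
    finrank ℝ (crossBlock U) = (n - #U - 1) * (#U - 1) ∧
    finrank ℝ (stdSpace U) = #U - 1 ∧ finrank ℝ (stdSpace Uᶜ) = n - #U - 1 ∧
    Function.Bijective (blockMap U) := by
  have hinj := blockMap_injective h1 h2
  have hle := LinearMap.finrank_le_finrank_of_injective hinj
  obtain ⟨u₀, hu₀⟩ : U.Nonempty := card_pos.1 (by omega)
  have a1 := card_inside_le U
  have a2 := card_inside_le Uᶜ
  have b1 := two_mul_card_inside U
  have b2 := two_mul_card_inside Uᶜ
  have a3 := card_cross_le hu₀
  have a4 := card_le_finrank_stdSpace U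
  have a5 := card_le_finrank_stdSpace Uᶜ
  have a6 := card_edge_add (n := n)
  have hsurj : finrank ℝ (((((((Fin n → ℝ) × insideBlock U) × insideBlock Uᶜ) × crossBlock U) ×
      stdSpace U) × stdSpace Uᶜ) × (Fin 2 → ℝ)) = finrank ℝ (Option (Edge n) → ℝ) →
      Function.Bijective (blockMap U) := fun h =>
    ⟨hinj, (LinearMap.injective_iff_surjective_of_finrank_eq_finrank h).1 hinj⟩
  simp only [finrank_prod, finrank_fintype_fun_eq_card, Fintype.card_fin,
    Fintype.card_option] at hle hsurj
  have hc : #Uᶜ = n - #U := by rw [card_compl, Fintype.card_fin]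
  rw [hc] at a2 b2 a3 a5
  obtain ⟨k, hk⟩ : ∃ k, #U = k + 3 := ⟨#U - 3, by omega⟩
  obtain ⟨l, hl⟩ : ∃ l, n - #U = l + 3 := ⟨n - #U - 3, by omega⟩
  have hn : n = k + l + 6 := by omega
  rw [hl] at a2 b2 a3 a5
  rw [hk] at a1 b1 a3 a4
  have hnn : n * n = (k + l + 6) * (k + l + 6) := by rw [← hn]
  rw [hnn] at a6
  ring_nf at b1 b2 a3 a6
  have hkl : l * k = k * l := mul_comm l k
  have x1 : finrank ℝ (insideBlock U) * 2 = (k + 3) * k := by ring_nf; omega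
  have x2 : finrank ℝ (insideBlock Uᶜ) * 2 = (l + 3) * l := by ring_nf; omega
  have x3 : finrank ℝ (crossBlock U) = (l + 2) * (k + 2) := by ring_nf; omega
  refine ⟨?_, ?_, ?_, by omega, by omega, hsurj (by omega)⟩
  · rw [hk, Nat.add_sub_cancel]; omega
  · rw [hl, Nat.add_sub_cancel]; omega
  · rw [hl, hk]; exact x3

/-- The action of the form matrix of `1 + a X`, `X = h_U - 1`, on the blocks. -/
noncomputable def blockAction (U : Finset (Fin n)) (a : ℝ) :
    End ℝ (((((((Fin n → ℝ) × insideBlock U) × insideBlock Uᶜ) × crossBlock U) × stdSpace U) ×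
      stdSpace Uᶜ) × (Fin 2 → ℝ)) :=
  (((((((0 : ℝ) • LinearMap.id).prodMap
    ((2 / (n - 1) + a * (2 / (n - 1) * insideWeight n #U)) • LinearMap.id)).prodMap
    ((2 / (n - 1) + a * (2 / (n - 1) * insideWeight n (n - #U))) • LinearMap.id)).prodMap
    ((2 / (n - 1) + a * (2 / ((n - 1) * (n - 2) * (n - 3)) * (insideWeight n #U +
        insideWeight n (n - #U) + (n - 1) * (n - 4) * (1 / (n - 2))))) • LinearMap.id)).prodMap
    ((2 / (n - 1) + a * (2 / ((n - 1) * (n - 3)) * ((n - 3) * insideWeight n #U -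
        (#U - 2) * (insideWeight n #U - 1 / (n - 2))))) • LinearMap.id)).prodMap
    ((2 / (n - 1) + a * (2 / ((n - 1) * (n - 3)) * ((n - 3) * insideWeight n (n - #U) -
        (n - #U - 2) * (insideWeight n (n - #U) - 1 / (n - 2))))) • LinearMap.id)).prodMap
    (Matrix.toLin' (invariantMatrix U a))

lemma formMatrix_blockMap {U : Finset (Fin n)} (h1 : 3 ≤ #U) (h2 : #U + 3 ≤ n) (a : ℝ) :
    (formMatrix fun T => 1 + a * form (cutWeight U) T).toLin' ∘ₗ blockMap U =
      blockMap U ∘ₗ blockAction U a := by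
  have hc : #Uᶜ = n - #U := by rw [card_compl, Fintype.card_fin]
  refine LinearMap.ext fun p => ?_
  have i2 := formMatrix_mulVec_inside (U := Uᶜ) (by omega) (by omega) a p.1.1.1.1.2.2
  have i6 := formMatrix_mulVec_std (U := Uᶜ) (by omega) (by omega) a p.1.2.2
  rw [cutWeight_compl, cast_card_compl] at i2 i6
  simp only [LinearMap.comp_apply, Matrix.toLin'_apply]
  rw [blockMap_apply, blockMap_apply]
  simp only [map_add, Matrix.mulVec_add]
  rw [formMatrix_mulVec_null, formMatrix_mulVec_inside h1 h2 a p.1.1.1.1.1.2.2, i2,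
    formMatrix_mulVec_cross h1 h2 a p.1.1.1.2.2, formMatrix_mulVec_std h1 h2 a p.1.1.2.2, i6,
    formMatrix_mulVec_invariant h1 h2]
  simp only [blockAction, LinearMap.prodMap_apply, LinearMap.smul_apply, LinearMap.id_apply,
    Matrix.toLin'_apply, Submodule.coe_smul, map_smul, zero_smul, LinearMap.zero_apply,
    map_zero, Pi.zero_apply, sum_const_zero, mul_zero]
  simp only [← map_smul, Prod.smul_mk, smul_zero, Prod.mk_zero_zero, map_zero]

lemma charpoly_smul_id {V : Type*} [AddCommGroup V] [Module ℝ V] [FiniteDimensional ℝ V] (c : ℝ) :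
    (c • (LinearMap.id : V →ₗ[ℝ] V)).charpoly = (Polynomial.X - Polynomial.C c) ^ finrank ℝ V := by
  rw [← LinearMap.charpoly_toMatrix _ (finBasis ℝ V), map_smul, LinearMap.toMatrix_id,
    Matrix.smul_one_eq_diagonal, Matrix.charpoly_diagonal]
  simp

lemma charpoly_eq_of_comp_eq {V W : Type*} [AddCommGroup V] [Module ℝ V] [FiniteDimensional ℝ V]
    [AddCommGroup W] [Module ℝ W] [FiniteDimensional ℝ W] {A : End ℝ W} {D : End ℝ V}
    {Φ : V →ₗ[ℝ] W} (hΦ : Function.Bijective Φ) (h : A ∘ₗ Φ = Φ ∘ₗ D) :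
    A.charpoly = D.charpoly := by
  rw [← (LinearEquiv.ofBijective Φ hΦ).charpoly_conj D]
  congr 1
  refine LinearMap.ext fun w => ?_
  obtain ⟨v, rfl⟩ := hΦ.2 w
  have h1 : (LinearEquiv.ofBijective Φ hΦ).symm (Φ v) = v :=
    (LinearEquiv.ofBijective Φ hΦ).symm_apply_apply v
  rw [LinearEquiv.conj_apply_apply, h1]
  exact LinearMap.congr_fun h v

lemma eigenvalues_one_add_form {U : Finset (Fin n)} (h1 : 3 ≤ #U) (h2 : #U + 3 ≤ n) (a r s : ℝ)
    (htr : (invariantMatrix U a).trace = r + s) (hdet : (invariantMatrix U a).det = r * s) :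
    eigenvalues (fun T => 1 + a * form (cutWeight U) T) =
      Multiset.replicate n (0 : ℝ) +
      Multiset.replicate (#U * (#U - 3) / 2)
        (2 / (n - 1) + a * (2 / (n - 1) * insideWeight n #U)) +
      Multiset.replicate ((n - #U) * (n - #U - 3) / 2)
        (2 / (n - 1) + a * (2 / (n - 1) * insideWeight n (n - #U))) +
      Multiset.replicate ((n - #U - 1) * (#U - 1))
        (2 / (n - 1) + a * (2 / ((n - 1) * (n - 2) * (n - 3)) * (insideWeight n #U +
          insideWeight n (n - #U) + (n - 1) * (n - 4) * (1 / (n - 2))))) +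
      Multiset.replicate (#U - 1)
        (2 / (n - 1) + a * (2 / ((n - 1) * (n - 3)) * ((n - 3) * insideWeight n #U -
          (#U - 2) * (insideWeight n #U - 1 / (n - 2))))) +
      Multiset.replicate (n - #U - 1)
        (2 / (n - 1) + a * (2 / ((n - 1) * (n - 3)) * ((n - 3) * insideWeight n (n - #U) -
          (n - #U - 2) * (insideWeight n (n - #U) - 1 / (n - 2))))) + {r} + {s} := by
  obtain ⟨d1, d2, d3, d4, d5, hbij⟩ := finrank_blocks h1 h2
  have hinv : (invariantMatrix U a).charpoly =
      (Polynomial.X - Polynomial.C r) * (Polynomial.X - Polynomial.C s) := by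
    rw [Matrix.charpoly_fin_two, htr, hdet]
    simp only [map_add, map_mul]
    ring
  rw [eigenvalues, ← Matrix.charpoly_toLin',
    charpoly_eq_of_comp_eq hbij (formMatrix_blockMap h1 h2 a), blockAction,
    LinearMap.charpoly_prodMap, LinearMap.charpoly_prodMap, LinearMap.charpoly_prodMap,
    LinearMap.charpoly_prodMap, LinearMap.charpoly_prodMap, LinearMap.charpoly_prodMap,
    Matrix.charpoly_toLin', hinv]
  simp only [charpoly_smul_id, d1, d2, d3, d4, d5, finrank_fintype_fun_eq_card, Fintype.card_fin]
  have hX : ∀ c : ℝ, Polynomial.X - Polynomial.C c ≠ 0 := Polynomial.X_sub_C_ne_zero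
  have hXp : ∀ (c : ℝ) (k : ℕ), (Polynomial.X - Polynomial.C c) ^ k ≠ 0 :=
    fun c k => pow_ne_zero k (hX c)
  have hmul : ∀ p q : Polynomial ℝ, p ≠ 0 → q ≠ 0 → (p * q).roots = p.roots + q.roots :=
    fun p q hp hq => Polynomial.roots_mul (mul_ne_zero hp hq)
  rw [hmul, hmul, hmul, hmul, hmul, hmul, hmul]
  · simp only [Polynomial.roots_pow, Polynomial.roots_X_sub_C, Multiset.nsmul_singleton, add_assoc]
  all_goals simp only [ne_eq, mul_eq_zero, not_or, hX, hXp, not_false_eq_true, and_self]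

/-! ### The subtour function and the eigenvalues of its form -/

lemma cutExcess_eq {U : Finset (Fin n)} (h1 : 3 ≤ #U) (h2 : #U + 3 ≤ n) (T : Tour n) :
    cutExcess U T =
      2 * ((#U - 1) * (n - #U - 1)) / (n - 1) * (1 + form (cutWeight U) T) := by
  have m1 : (3 : ℝ) ≤ #U := by exact_mod_cast h1
  have m2 : (#U : ℝ) + 3 ≤ n := by exact_mod_cast h2
  have e1 : (n : ℝ) - 1 ≠ 0 := by linarith
  have e2 : (n : ℝ) - 2 ≠ 0 := by linarith
  have e5 : (n : ℝ) - #U - 1 ≠ 0 := by linarith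
  have e6 : (#U : ℝ) - 1 ≠ 0 := by linarith
  set C := ∑ u ∈ U, ∑ v ∈ Uᶜ, T.x s(u, v) with hC
  have hdeg : ∀ u, ∑ v ∈ U, T.x s(u, v) = 2 - ∑ v ∈ Uᶜ, T.x s(u, v) := fun u => by
    rw [eq_sub_iff_add_eq, sum_add_sum_compl, T.sum_x]
  have hC' : ∑ u ∈ Uᶜ, ∑ v ∈ U, T.x s(u, v) = C := by
    rw [hC, sum_comm]; simp only [Sym2.eq_swap]
  have hUU : ∑ u ∈ U, ∑ v ∈ U, T.x s(u, v) = 2 * #U - C := by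
    simp only [hdeg, sum_sub_distrib, sum_const, nsmul_eq_mul, ← hC]
    ring
  have hWW : ∑ u ∈ Uᶜ, ∑ v ∈ Uᶜ, T.x s(u, v) = 2 * (n - #U) - C := by
    have := hC'
    simp only [hdeg, sum_sub_distrib, sum_const, nsmul_eq_mul, cast_card_compl] at this
    linarith
  have hform : form (cutWeight U) T = (insideWeight n #U * (2 * #U - C) + 2 * (1 / (n - 2) * C) +
      insideWeight n (n - #U) * (2 * (n - #U) - C)) / 2 := by
    rw [form, ← sum_add_sum_compl U,
      sum_congr rfl fun a ha => sum_cutWeight_mul U ha fun v => T.x s(a, v),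
      sum_congr rfl fun a ha => sum_cutWeight_mul' U (mem_compl.1 ha) fun v => T.x s(a, v)]
    simp only [T.x_diag, sub_zero, sum_add_distrib, ← mul_sum, hUU, hWW, hC', ← hC]
    ring
  rw [hform, cutExcess, ← hC, insideWeight, insideWeight, sub_sub_cancel]
  field_simp
  ring

lemma avg_cutExcess {U : Finset (Fin n)} (h1 : 3 ≤ #U) (h2 : #U + 3 ≤ n) :
    avg (cutExcess U) = 2 * ((#U - 1) * (n - #U - 1)) / (n - 1) := by
  have := funext (cutExcess_eq h1 h2)
  rw [this]
  simp only [avg_const_mul, avg_add, avg_const (by omega : 3 ≤ n)]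
  rw [avg_form (by omega) (balanced_cutWeight U h1 h2)]
  ring

lemma h_eq {U : Finset (Fin n)} (h1 : 3 ≤ #U) (h2 : #U + 3 ≤ n) :
    h U = fun T => 1 + form (cutWeight U) T := by
  have m1 : (3 : ℝ) ≤ #U := by exact_mod_cast h1
  have m2 : (#U : ℝ) + 3 ≤ n := by exact_mod_cast h2
  have e1 : (n : ℝ) - 1 ≠ 0 := by linarith
  have e5 : (n : ℝ) - #U - 1 ≠ 0 := by linarith
  have e6 : (#U : ℝ) - 1 ≠ 0 := by linarith
  funext T
  rw [h, avg_cutExcess h1 h2, cutExcess_eq h1 h2]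
  field_simp

lemma scaled_eq {U : Finset (Fin n)} (h1 : 3 ≤ #U) (h2 : #U + 3 ≤ n) (a : ℝ) :
    scaled a U = fun T => 1 + a * form (cutWeight U) T := by
  funext T
  rw [scaled, h_eq h1 h2]
  ring

lemma isLinearOnTours_form {M : Matrix (Fin n) (Fin n) ℝ} (hM : ∀ u v, M u v = M v u) :
    IsLinearOnTours (form M) := by
  refine ⟨∑ e : Edge n, coeffVec (0, M) (some e) • LinearMap.proj e, fun T => ?_⟩
  have h := sum_coeffVec_mul_mono (0, M) hM T
  rw [Fintype.sum_option, coeffVec_none, zero_mul, zero_add, zero_add] at h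
  rw [← h]
  simp [mono]

lemma isLinearOnTours_h {U : Finset (Fin n)} (h1 : 3 ≤ #U) (h2 : #U + 3 ≤ n) :
    IsLinearOnTours (h U) := by
  -- by the degree equations the constant `1` is linear on tours
  have hn : (n : ℝ) ≠ 0 := by exact_mod_cast (by omega : n ≠ 0)
  have : h U = form (vertexMat (fun _ => 1 / (2 * (n : ℝ))) + cutWeight U) := by
    rw [h_eq h1 h2]
    funext T
    rw [form_add, form_vertexMat]
    simp only [sum_const, card_univ, Fintype.card_fin, nsmul_eq_mul]
    field_simp
  rw [this]
  exact isLinearOnTours_form fun u v => by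
    simp [vertexMat_symm _ u v, cutWeight_symm U u v]

lemma trace_invariantMatrix {U : Finset (Fin n)} (h1 : 3 ≤ #U) (h2 : #U + 3 ≤ n) (a : ℝ) :
    (invariantMatrix U a).trace = 2 * alpha a #U n := by
  have m1 : (3 : ℝ) ≤ #U := by exact_mod_cast h1
  have m2 : (#U : ℝ) + 3 ≤ n := by exact_mod_cast h2
  have e1 : (n : ℝ) - 1 ≠ 0 := by linarith
  rw [Matrix.trace_fin_two]
  simp only [invariantMatrix, alpha, Matrix.of_apply, Matrix.cons_val', Matrix.cons_val_zero,
    Matrix.cons_val_one]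
  rw [mul_sub, mul_div_assoc a]
  field_simp
  ring

/-- `β` is the discriminant of the characteristic polynomial of `invariantMatrix U a`. -/
lemma beta_eq {U : Finset (Fin n)} (h1 : 3 ≤ #U) (h2 : #U + 3 ≤ n) (a : ℝ) :
    beta a #U n = ((invariantMatrix U a 0 0 - invariantMatrix U a 1 1) / 2) ^ 2 +
      invariantMatrix U a 0 1 * invariantMatrix U a 1 0 := by
  have m1 : (3 : ℝ) ≤ #U := by exact_mod_cast h1
  have m2 : (#U : ℝ) + 3 ≤ n := by exact_mod_cast h2
  have e1 : (n : ℝ) - 1 ≠ 0 := by linarith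
  have e2 : (n : ℝ) - 2 ≠ 0 := by linarith
  have e3 : (n : ℝ) - 3 ≠ 0 := by linarith
  have e5 : (n : ℝ) - #U - 1 ≠ 0 := by linarith
  have e6 : (#U : ℝ) - 1 ≠ 0 := by linarith
  simp only [invariantMatrix, beta, Matrix.of_apply, Matrix.cons_val', Matrix.cons_val_zero,
    Matrix.cons_val_one, edgeInner_cutWeight_self h1 h2]
  field_simp
  ring

lemma det_invariantMatrix {U : Finset (Fin n)} (h1 : 3 ≤ #U) (h2 : #U + 3 ≤ n) (a : ℝ) :
    (invariantMatrix U a).det = alpha a #U n ^ 2 - beta a #U n := by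
  have ht := trace_invariantMatrix h1 h2 a
  rw [Matrix.trace_fin_two] at ht
  have ht2 : alpha a #U n = (invariantMatrix U a 0 0 + invariantMatrix U a 1 1) / 2 := by linarith
  rw [beta_eq h1 h2, ht2, Matrix.det_fin_two]
  ring

/-- Both off-diagonal entries of `invariantMatrix U a` have the sign of `a`. -/
lemma beta_nonneg {U : Finset (Fin n)} (h1 : 3 ≤ #U) (h2 : #U + 3 ≤ n) (a : ℝ) :
    0 ≤ beta a #U n := by
  have m1 : (3 : ℝ) ≤ #U := by exact_mod_cast h1
  have m2 : (#U : ℝ) + 3 ≤ n := by exact_mod_cast h2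
  rw [beta_eq h1 h2]
  refine add_nonneg (sq_nonneg _) ?_
  have e1 : 0 < (n : ℝ) - 1 := by linarith
  have hI : 0 ≤ edgeInner (cutWeight U) (cutWeight U) :=
    div_nonneg (sum_nonneg fun u _ => sum_nonneg fun v _ => mul_self_nonneg _) two_pos.le
  have hν : 0 ≤ 3 * (n : ℝ) - 1 := by linarith
  have : invariantMatrix U a 0 1 * invariantMatrix U a 1 0 = a ^ 2 * ((2 / (n - 1)) *
      edgeInner (cutWeight U) (cutWeight U) * (2 / (n - 1)) * ((3 * n - 1) / (n - 1))) := by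
    simp only [invariantMatrix, Matrix.of_apply, Matrix.cons_val', Matrix.cons_val_zero,
      Matrix.cons_val_one]
    ring
  rw [this]
  positivity

/-- The eigenvalues of the form of `a h_U + (1 - a)`. -/
lemma eigenvalues_scaled {U : Finset (Fin n)} (h1 : 3 ≤ #U) (h2 : #U + 3 ≤ n) (a : ℝ) :
    eigenvalues (scaled a U) =
        Multiset.replicate n (0 : ℝ) +
        Multiset.replicate (#U * (#U - 3) / 2)
          (a * (2 * (#U - 2) / ((n - 2) * (#U - 1))) + (1 - a) * (2 / (n - 1))) +
        Multiset.replicate ((n - #U) * (n - #U - 3) / 2)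
          (a * (2 * (n - #U - 2) / ((n - 2) * (n - #U - 1))) + (1 - a) * (2 / (n - 1))) +
        Multiset.replicate ((n - #U - 1) * (#U - 1))
          (a * (2 * (#U * n ^ 2 - n * #U ^ 2 - n ^ 2 + 4 * n - 3 * #U * n + 3 * #U ^ 2 - 4) /
            ((n - 2) * (n - 3) * (#U * n - #U ^ 2 - n + 1))) + (1 - a) * (2 / (n - 1))) +
        Multiset.replicate (#U - 1)
          (a * (2 * (#U - 2) / ((n - 3) * (#U - 1))) + (1 - a) * (2 / (n - 1))) +
        Multiset.replicate (n - #U - 1)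
          (a * (2 * (n - #U - 2) / ((n - 3) * (n - #U - 1))) + (1 - a) * (2 / (n - 1))) +
        {alpha a #U n + √(beta a #U n)} + {alpha a #U n - √(beta a #U n)} := by
  have m1 : (3 : ℝ) ≤ #U := by exact_mod_cast h1
  have m2 : (#U : ℝ) + 3 ≤ n := by exact_mod_cast h2
  have e1 : (n : ℝ) - 1 ≠ 0 := by linarith
  have e2 : (n : ℝ) - 2 ≠ 0 := by linarith
  have e3 : (n : ℝ) - 3 ≠ 0 := by linarith
  have e5 : (n : ℝ) - #U - 1 ≠ 0 := by linarith
  have e6 : (#U : ℝ) - 1 ≠ 0 := by linarith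
  have hs := Real.sq_sqrt (beta_nonneg h1 h2 a)
  rw [scaled_eq h1 h2, eigenvalues_one_add_form h1 h2 a (alpha a #U n + √(beta a #U n))
    (alpha a #U n - √(beta a #U n)) (by rw [trace_invariantMatrix h1 h2]; ring)
    (by rw [det_invariantMatrix h1 h2]; linear_combination hs)]
  have hden : (#U * n - #U ^ 2 - n + 1 : ℝ) = (#U - 1) * (n - #U - 1) := by ring
  have t1 : 2 / ((n : ℝ) - 1) + a * (2 / (n - 1) * insideWeight n #U) =
      a * (2 * (#U - 2) / ((n - 2) * (#U - 1))) + (1 - a) * (2 / (n - 1)) := by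
    rw [insideWeight]; field_simp; ring
  have t2 : 2 / ((n : ℝ) - 1) + a * (2 / (n - 1) * insideWeight n (n - #U)) =
      a * (2 * (n - #U - 2) / ((n - 2) * (n - #U - 1))) + (1 - a) * (2 / (n - 1)) := by
    rw [insideWeight, sub_sub_cancel]; field_simp; ring
  have t3 : 2 / ((n : ℝ) - 1) + a * (2 / ((n - 1) * (n - 2) * (n - 3)) * (insideWeight n #U +
        insideWeight n (n - #U) + (n - 1) * (n - 4) * (1 / (n - 2)))) =
      a * (2 * (#U * n ^ 2 - n * #U ^ 2 - n ^ 2 + 4 * n - 3 * #U * n + 3 * #U ^ 2 - 4) /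
        ((n - 2) * (n - 3) * (#U * n - #U ^ 2 - n + 1))) + (1 - a) * (2 / (n - 1)) := by
    rw [insideWeight, insideWeight, sub_sub_cancel, hden]; field_simp; ring
  have t4 : 2 / ((n : ℝ) - 1) + a * (2 / ((n - 1) * (n - 3)) * ((n - 3) * insideWeight n #U -
        (#U - 2) * (insideWeight n #U - 1 / (n - 2)))) =
      a * (2 * (#U - 2) / ((n - 3) * (#U - 1))) + (1 - a) * (2 / (n - 1)) := by
    rw [insideWeight]; field_simp; ring
  have t5 : 2 / ((n : ℝ) - 1) + a * (2 / ((n - 1) * (n - 3)) * ((n - 3) *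
        insideWeight n (n - #U) - (n - #U - 2) * (insideWeight n (n - #U) - 1 / (n - 2)))) =
      a * (2 * (n - #U - 2) / ((n - 3) * (n - #U - 1))) + (1 - a) * (2 / (n - 1)) := by
    rw [insideWeight, sub_sub_cancel]; field_simp; ring
  rw [t1, t2, t3, t4, t5]

/-! ### The subtour function scaled by `√n` -/

/-- The determinant is a positive factor times `-Q`, where the dominant term of `Q` is
`n (n - 1) (n - 3)`; its only negative term is `-√n (n - 2)`. -/
lemma det_invariantMatrix_sqrt_neg {U : Finset (Fin n)} (h1 : 3 ≤ #U) (h2 : #U + 3 ≤ n) :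
    (invariantMatrix U √n).det < 0 := by
  have m1 : (3 : ℝ) ≤ #U := by exact_mod_cast h1
  have m2 : (#U : ℝ) + 3 ≤ n := by exact_mod_cast h2
  have e1 : 0 < (n : ℝ) - 1 := by linarith
  have e2 : 0 < (n : ℝ) - 2 := by linarith
  have e3 : 0 < (n : ℝ) - 3 := by linarith
  have e5 : 0 < (n : ℝ) - #U - 1 := by linarith
  have e6 : 0 < (#U : ℝ) - 1 := by linarith
  have hr : √(n : ℝ) ^ 2 = n := Real.sq_sqrt (by linarith)
  have hr0 : 0 ≤ √(n : ℝ) := Real.sqrt_nonneg _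
  have hrn : √(n : ℝ) ≤ n := Real.sqrt_le_self_iff.2 (Or.inr (by linarith))
  have key : (invariantMatrix U √n).det = -(2 * (3 * n - 1) / ((n - 1) ^ 2 * ((#U - 1) *
      (n - #U - 1)) * (n - 2) * (n - 3))) * (2 * ((#U - 1) * (n - #U - 1)) * (n - 3) +
        n * (n - 1) * (n - 3) - √n * (n - 2) + (n - 2 * #U) ^ 2 * √n * (n - 2)) := by
    rw [Matrix.det_fin_two]
    simp only [invariantMatrix, Matrix.of_apply, Matrix.cons_val', Matrix.cons_val_zero,
      Matrix.cons_val_one, edgeInner_cutWeight_self h1 h2]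
    field_simp
    rw [hr]
    ring
  have hpos : 0 < 2 * (((#U : ℝ) - 1) * (n - #U - 1)) * (n - 3) +
        n * (n - 1) * (n - 3) - √n * (n - 2) + (n - 2 * #U) ^ 2 * √n * (n - 2) := by
    have p1 : 0 ≤ ((n : ℝ) - 2 * #U) ^ 2 * √n * (n - 2) := by positivity
    have p2 : 0 < 2 * (((#U : ℝ) - 1) * (n - #U - 1)) * (n - 3) := by positivity
    have p3 : √(n : ℝ) * (n - 2) ≤ n * (n - 2) := mul_le_mul_of_nonneg_right hrn e2.le
    have p4 : (n : ℝ) * (n - 2) ≤ n * (n - 1) * (n - 3) := by nlinarith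
    linarith
  have hc : 0 < 2 * (3 * (n : ℝ) - 1) / ((n - 1) ^ 2 * ((#U - 1) * (n - #U - 1)) * (n - 2) *
      (n - 3)) := by
    have : 0 < 3 * (n : ℝ) - 1 := by linarith
    positivity
  rw [key, neg_mul]
  exact neg_neg_of_pos (mul_pos hc hpos)

lemma alpha_sub_sqrt_beta_neg {U : Finset (Fin n)} (h1 : 3 ≤ #U) (h2 : #U + 3 ≤ n) :
    alpha √n #U n - √(beta √n #U n) < 0 := by
  have h := det_invariantMatrix_sqrt_neg h1 h2
  rw [det_invariantMatrix h1 h2] at h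
  exact sub_neg.2 (Real.lt_sqrt_of_sq_lt (sub_neg.1 h))

lemma totalDegree_sum_mono_le (c : Option (Edge n) → ℝ) :
    (∑ i, c i • mono i : MvPolynomial (Edge n) ℝ).totalDegree ≤ 1 := by
  refine MvPolynomial.totalDegree_finsetSum_le fun i _ => ?_
  refine (MvPolynomial.totalDegree_smul_le _ _).trans ?_
  rcases i with _ | e
  · simp [mono]
  · simp [mono]

/-- The form of a function in `P_1` has no negative eigenvalue. -/
lemma eigenvalue_nonneg_of_mem_P {f : Tour n → ℝ} (hf : f ∈ P n 1) {μ : ℝ}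
    (hμ : μ ∈ eigenvalues f) : 0 ≤ μ := by
  have hroot : (formMatrix f).toLin'.charpoly.IsRoot μ := by
    rw [Matrix.charpoly_toLin']
    exact Polynomial.isRoot_of_mem_roots hμ
  obtain ⟨v, hv⟩ :=
    ((Module.End.hasEigenvalue_iff_isRoot_charpoly _ _).2 hroot).exists_hasEigenvector
  have hAv : (formMatrix f).mulVec v = μ • v := by
    rw [← Matrix.toLin'_apply]
    exact hv.apply_eq_smul
  have h := hf.2.2 _ (totalDegree_sum_mono_le v)
  rw [q_eq_formMatrix, hAv, dotProduct_smul, smul_eq_mul] at h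
  have hpos : 0 < v ⬝ᵥ v := lt_of_le_of_ne (sum_nonneg fun i _ => mul_self_nonneg _)
    fun h0 => hv.2 (dotProduct_self_eq_zero.1 h0.symm)
  exact nonneg_of_mul_nonneg_left h hpos

/-- The subtour function scaled by `√n` is strictly outside `P_1`. -/
lemma scaled_sqrt_notMem_P {U : Finset (Fin n)} (h1 : 3 ≤ #U) (h2 : #U + 3 ≤ n) :
    scaled √n U ∉ P n 1 := by
  intro hf
  refine (alpha_sub_sqrt_beta_neg h1 h2).not_ge (eigenvalue_nonneg_of_mem_P hf ?_)
  rw [eigenvalues_scaled h1 h2]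
  simp

end TSP

theorem theorem3 (n m : ℕ) (hn : 6 ≤ n) (hm : 3 ≤ m) (hmn : 2 * m ≤ n)
    (U : Finset (Fin n)) (hU : U.card = m) :
    (TSP.IsLinearOnTours (TSP.h U) ∧ TSP.avg (TSP.h U) = 1) ∧
    (∀ a : ℝ,
      0 ≤ TSP.beta a m n ∧
      TSP.eigenvalues (TSP.scaled a U) =
        Multiset.replicate n (0 : ℝ) +
        Multiset.replicate (m * (m - 3) / 2)
          (a * (2 * (m - 2) / ((n - 2) * (m - 1))) + (1 - a) * (2 / (n - 1))) +
        Multiset.replicate ((n - m) * (n - m - 3) / 2)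
          (a * (2 * (n - m - 2) / ((n - 2) * (n - m - 1))) + (1 - a) * (2 / (n - 1))) +
        Multiset.replicate ((n - m - 1) * (m - 1))
          (a * (2 * (m * n ^ 2 - n * m ^ 2 - n ^ 2 + 4 * n - 3 * m * n + 3 * m ^ 2 - 4) /
            ((n - 2) * (n - 3) * (m * n - m ^ 2 - n + 1))) + (1 - a) * (2 / (n - 1))) +
        Multiset.replicate (m - 1)
          (a * (2 * (m - 2) / ((n - 3) * (m - 1))) + (1 - a) * (2 / (n - 1))) +
        Multiset.replicate (n - m - 1)
          (a * (2 * (n - m - 2) / ((n - 3) * (n - m - 1))) + (1 - a) * (2 / (n - 1))) +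
        {TSP.alpha a m n + √(TSP.beta a m n)} +
        {TSP.alpha a m n - √(TSP.beta a m n)}) ∧
    TSP.alpha √n m n - √(TSP.beta √n m n) ≤ 0 ∧
    (TSP.scaled √n U ∉ TSP.P n 1 ∨
      TSP.scaled √n U ∈ intrinsicFrontier ℝ (TSP.P n 1)) := by
  subst hU
  have h2 : U.card + 3 ≤ n := by omega
  refine ⟨⟨TSP.isLinearOnTours_h hm h2, ?_⟩,
    fun a => ⟨TSP.beta_nonneg hm h2 a, TSP.eigenvalues_scaled hm h2 a⟩,
    (TSP.alpha_sub_sqrt_beta_neg hm h2).le, Or.inl (TSP.scaled_sqrt_notMem_P hm h2)⟩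
  simp only [TSP.h_eq hm h2]
  rw [TSP.avg_add, TSP.avg_const (by omega), TSP.avg_form hn (TSP.balanced_cutWeight U hm h2),
    add_zero]
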